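/- **Setting.** Let $k\ge 0$ and let $\Pi$ be a finite collection of $k$-ary predicates $P\colon\{0,1\}^k\to\{0,1\}$ (a boolean CSP). A $\Pi$-instance $\Im$ on $n$ variables is a nonempty finite list of constraints $P_1,\dots,P_M$ on $\{0,1\}^n$ (repetitions allowed), each of the form $x\mapsto P(x_{i_1},\dots,x_{i_k})$ with $P\in\Pi$ and distinct indices $i_1,\dots,i_k\in\{1,\dots,n\}$. Put $\Im(x)=\frac1M\sum_{j=1}^M P_j(x)$ and $\mathrm{opt}(\Im)=\max_{x\in\{0,1\}^n}\Im(x)$, and let $\Pi_n$ be the set of instances on $n$ variables. For a linear subspace $U\subseteq\mathbb R^{\{0,1\}^n}$ and $f\colon\{0,1\}^n\to\mathbb R$, let $\overline{\mathrm{sos}}_U(f)$ be the smallest $a\in\mathbb R$ such that $a-f=g_1^2+\dots+g_t^2$ on $\{0,1\}^n$ for some $t\in\mathbb N$ and $g_1,\dots,g_t\in U$ (and $+\infty$ if there is no such $a$). For $c,s\in\mathbb R$, the subspace $U$ *achieves a $(c,s)$-approximation for $\Pi_n$* if every $\Im\in\Pi_n$ with $\mathrm{opt}(\Im)\le s$ satisfies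 $\overline{\mathrm{sos}}_U(\Im)\le c$. *Degree-$d$ sum-of-squares* on $n$-variable instances is the case in which $U$ is the space of functions $g\colon\{0,1\}^n\to\mathbb R$ of degree (as multilinear polynomials) at most $d/2$. An *SDP relaxation of size $r$ for $\Pi_n$* consists of matrices $\tilde\Im\in\mathbb R^{r\times r}$ for $\Im\in\Pi_n$, matrices $\tilde x\in\mathbb R^{r\times r}$ for $x\in\{0,1\}^n$, and an affine subspace $L\subseteq\mathbb R^{r\times r}$, such that $\langle\tilde\Im,\tilde x\rangle=\Im(x)$ for all $\Im$ and $x$, and $\tilde x\in\mathcal S$ for all $x$, where $\mathcal S$ is the set of symmetric positive semidefinite matrices in $L$ and $\langle A,B\rangle=\mathrm{Tr}(A^{T}B)$. It *achieves a $(c,s)$-approximation for $\Pi_n$* if $\sup_{y\in\mathcal S}\langle\tilde\Im,y\rangle\le c$ for every $\Im\in\Pi_n$ with $\mathrm{opt}(\Im)\le s$. **Theorem.** Let $\Pi$ be a boolean CSP, $m\in\mathbb N$ and $c,s\in\mathbb R$. There is a number $\alpha=\alpha(\Pi,m,c,s)>0$ such that the following holds for every $d\in\mathbb N$. If degree-$d$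 sum-of-squares fails to achieve a $(c,s)$-approximation for $\Pi_m$, then for every $n\ge\max(m,2)$: 1. every linear subspace $U$ of functions $\{0,1\}^n\to\mathbb R$ with $\dim U\le\alpha\,(n/\log n)^{d/4}$ fails to achieve a $(c,s)$-approximation for $\Pi_n$; 2. every SDP relaxation for $\Pi_n$ of size at most $\alpha\,(n/\log n)^{d/4}$ fails to achieve a $(c,s)$-approximation for $\Pi_n$. -/

import Mathlib

/-! ### Functions on the discrete cube and their degree -/

/-- The discrete cube `{0,1}^n`. -/
abbrev Cube (n : ℕ) : Type := Fin n → Bool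

/-- The character `χ_S(x) = ∏_{i ∈ S} (2 x_i - 1)`. -/
noncomputable def cubeChar {n : ℕ} (S : Finset (Fin n)) (x : Cube n) : ℝ :=
  ∏ i ∈ S, (if x i then (1 : ℝ) else -1)

/-- The Fourier coefficient of `f` at `S`, for the uniform measure on the cube. -/
noncomputable def fourierCoefficient {n : ℕ} (f : Cube n → ℝ) (S : Finset (Fin n)) : ℝ :=
  (∑ x, f x * cubeChar S x) / (2 : ℝ) ^ n

open Classical in
/-- The degree `max {|S| : f̂(S) ≠ 0}` of a function on the cube (`0` for the zero function); it is
the degree of the unique multilinear polynomial that agrees with `f` on the cube. -/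
noncomputable def cubeDegree {n : ℕ} (f : Cube n → ℝ) : ℕ :=
  (Finset.univ.filter fun S : Finset (Fin n) => fourierCoefficient f S ≠ 0).sup Finset.card

theorem cubeDegree_le_iff {n : ℕ} (f : Cube n → ℝ) (t : ℕ) :
    cubeDegree f ≤ t ↔ ∀ S : Finset (Fin n), t < S.card → fourierCoefficient f S = 0 := by
  classical
  unfold cubeDegree
  rw [Finset.sup_le_iff]
  constructor
  · intro h S hS
    by_contra hne
    exact absurd (h S (by simp [hne])) (not_le.mpr hS)
  · intro h S hS
    by_contra hlt
    exact (Finset.mem_filter.mp hS).2 (h S (not_le.mp hlt))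

/-- The subspace of the functions `g` with `deg g ≤ d / 2`, whose squares generate the degree-`d`
sum-of-squares certificates. -/
noncomputable def sosSubspace (n d : ℕ) : Submodule ℝ (Cube n → ℝ) where
  carrier := {g | 2 * cubeDegree g ≤ d}
  zero_mem' := by
    have h : cubeDegree (0 : Cube n → ℝ) ≤ 0 :=
      (cubeDegree_le_iff _ _).mpr fun S _ => by simp [fourierCoefficient]
    simp only [Set.mem_ofPred_eq]
    omega
  add_mem' := by
    intro f g hf hg
    simp only [Set.mem_ofPred_eq] at hf hg ⊢
    have h : cubeDegree (f + g) ≤ d / 2 := by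
      have hf' := (cubeDegree_le_iff f (d / 2)).mp (by omega)
      have hg' := (cubeDegree_le_iff g (d / 2)).mp (by omega)
      refine (cubeDegree_le_iff _ _).mpr fun S hS => ?_
      have h1 := hf' S hS
      have h2 := hg' S hS
      unfold fourierCoefficient at h1 h2 ⊢
      simp only [Pi.add_apply, add_mul, Finset.sum_add_distrib, add_div, h1, h2, add_zero]
    omega
  smul_mem' := by
    intro a f hf
    simp only [Set.mem_ofPred_eq] at hf ⊢
    have h : cubeDegree (a • f) ≤ d / 2 := by
      have hf' := (cubeDegree_le_iff f (d / 2)).mp (by omega)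
      refine (cubeDegree_le_iff _ _).mpr fun S hS => ?_
      have h1 := hf' S hS
      unfold fourierCoefficient at h1 ⊢
      simp only [Pi.smul_apply, smul_eq_mul, mul_assoc, ← Finset.mul_sum, mul_div_assoc, h1,
        mul_zero]
    omega

/-! ### Sum-of-squares upper bounds -/

/-- `f = g_1² + ⋯ + g_t²` on the cube, for some `t ∈ ℕ` and `g_1, …, g_t ∈ U`. -/
def IsSumSqOf {n : ℕ} (U : Submodule ℝ (Cube n → ℝ)) (f : Cube n → ℝ) : Prop :=
  ∃ (t : ℕ) (g : Fin t → Cube n → ℝ), (∀ j, g j ∈ U) ∧ ∀ x, f x = ∑ j, g j x ^ 2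

/-- The subspace-`U` sum-of-squares upper bound for `f`: the smallest real `a` such that `a - f` is
a sum of squares of functions from `U`, and `⊤` if there is no such `a`. -/
noncomputable def sosUpperBound {n : ℕ} (U : Submodule ℝ (Cube n → ℝ)) (f : Cube n → ℝ) : EReal :=
  sInf {b : EReal | ∃ a : ℝ, b = (a : EReal) ∧ IsSumSqOf U fun x => a - f x}

/-! ### Boolean constraint satisfaction problems -/

/-- A constraint `P(X_{i_1}, …, X_{i_k})` on `n` variables, with `P` in the given collection of
`k`-ary predicates and `i_1, …, i_k` distinct. -/
structure CSPConstraint {k : ℕ} (Preds : Finset ((Fin k → Bool) → Bool)) (n : ℕ) where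
  pred : (Fin k → Bool) → Bool
  pred_mem : pred ∈ Preds
  index : Fin k ↪ Fin n

/-- An instance on `n` variables: a nonempty finite family of constraints (repetition allowed). -/
structure CSPInstance {k : ℕ} (Preds : Finset ((Fin k → Bool) → Bool)) (n : ℕ) where
  size : ℕ
  size_pos : 0 < size
  constraint : Fin size → CSPConstraint Preds n

namespace CSPInstance

variable {k : ℕ} {Preds : Finset ((Fin k → Bool) → Bool)} {n : ℕ}

/-- The fraction of the constraints that the assignment `x` satisfies. -/
noncomputable def value (I : CSPInstance Preds n) (x : Cube n) : ℝ :=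
  (∑ j, if (I.constraint j).pred (fun i => x ((I.constraint j).index i)) then (1 : ℝ) else 0)
    / (I.size : ℝ)

/-- The optimal value `max_x I(x)`. -/
noncomputable def opt (I : CSPInstance Preds n) : ℝ :=
  Finset.univ.sup' Finset.univ_nonempty I.value

end CSPInstance

/-- The subspace `U` achieves a `(c,s)`-approximation on `n`-variable instances: every instance
with `opt ≤ s` has subspace-`U` sum-of-squares upper bound at most `c`. -/
def SubspaceAchieves {k : ℕ} (Preds : Finset ((Fin k → Bool) → Bool)) {n : ℕ}
    (U : Submodule ℝ (Cube n → ℝ)) (c s : ℝ) : Prop :=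
  ∀ I : CSPInstance Preds n, I.opt ≤ s → sosUpperBound U I.value ≤ (c : EReal)

/-! ### Semidefinite programming relaxations -/

/-- The entrywise inner product `Tr(Aᵀ B)` on `r × r` matrices. -/
def matrixInner {r : ℕ} (A B : Matrix (Fin r) (Fin r) ℝ) : ℝ :=
  (A.transpose * B).trace

/-- An SDP relaxation of size `r` for the `n`-variable instances: a linearization of instances and
assignments by `r × r` matrices, and a spectrahedron, independent of the instance, that contains
all linearized assignments. -/
structure SDPRelaxation {k : ℕ} (Preds : Finset ((Fin k → Bool) → Bool)) (n r : ℕ) where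
  linInstance : CSPInstance Preds n → Matrix (Fin r) (Fin r) ℝ
  linPoint : Cube n → Matrix (Fin r) (Fin r) ℝ
  inner_eq : ∀ (I : CSPInstance Preds n) (x : Cube n),
    matrixInner (linInstance I) (linPoint x) = I.value x
  affine : AffineSubspace ℝ (Matrix (Fin r) (Fin r) ℝ)
  point_affine : ∀ x, linPoint x ∈ affine
  point_psd : ∀ x, (linPoint x).PosSemidef

namespace SDPRelaxation

variable {k : ℕ} {Preds : Finset ((Fin k → Bool) → Bool)} {n r : ℕ}

/-- The feasible region: the psd matrices in the affine subspace. -/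
def feasible (R : SDPRelaxation Preds n r) : Set (Matrix (Fin r) (Fin r) ℝ) :=
  {Y | Y ∈ R.affine ∧ Y.PosSemidef}

/-- The value of the relaxation on an instance: the supremum (possibly `⊤`) of the linearized
objective over the feasible region. -/
noncomputable def value (R : SDPRelaxation Preds n r) (I : CSPInstance Preds n) : EReal :=
  ⨆ Y ∈ R.feasible, (matrixInner (R.linInstance I) Y : EReal)

/-- The relaxation achieves a `(c,s)`-approximation: every instance with `opt ≤ s` has relaxation
value at most `c`. -/
def Achieves (R : SDPRelaxation Preds n r) (c s : ℝ) : Prop :=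
  ∀ I : CSPInstance Preds n, I.opt ≤ s → R.value I ≤ (c : EReal)

end SDPRelaxation

/-!
If degree-`d` sum-of-squares fails on an instance with objective `I` on `m` variables, a separating
functional gives a bounded pseudo-density `D` with `𝔼 y, D y * (c - I y) < 0`. For a random
embedding `τ` of the `m` variables into `n`, a small relaxation would factor each function
`c - I (x ∘ τ)` of `x` as `tr (P τ * Q x)` with positive semidefinite `P τ` and `Q x`, up to a
nonnegative constant. After a change of basis `𝔼 τ, P τ ≤ 1`, so
`T x = 𝔼 τ, D (x ∘ τ) • P τ` satisfies `-1 ≤ T x ≤ 1`.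

A fixed small set of variables is unlikely to meet a random image of `τ` in more than `d / 2`
points. Hence a square `g x ^ 2` of moderate degree restricts, for most `τ`, to a square of degree
at most `d` up to a small error; `D` is nonnegative against such squares, so
`𝔼 x, tr (T x * R x ^ 2)` is almost nonnegative for every low-degree `R`. Taking `R = (1 - T) ^ k`,
which amplifies the negative eigenvalues of `T`, shows that `T` is almost nonnegative on average.
Then `𝔼 x, tr (T x * Q x) = 𝔼 τ, 𝔼 x, D (x ∘ τ) * tr (P τ * Q x)` cannot be as negative as the
choice of `D` forces it to be.
-/

section Fourier

open scoped BigOperators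

variable {n : ℕ}

theorem cubeChar_mul_cubeChar (S T : Finset (Fin n)) (x : Cube n) :
    cubeChar S x * cubeChar T x = cubeChar (symmDiff S T) x := by
  have hprod : ∀ S : Finset (Fin n),
      cubeChar S x = ∏ i, if i ∈ S then (if x i then (1 : ℝ) else -1) else 1 := fun S => by
    rw [cubeChar, Finset.prod_ite_mem, Finset.univ_inter]
  simp only [hprod, ← Finset.prod_mul_distrib, Finset.mem_symmDiff]
  refine Finset.prod_congr rfl fun i _ => ?_
  by_cases hS : i ∈ S <;> by_cases hT : i ∈ T <;> cases x i <;> simp [hS, hT]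

theorem cubeChar_flip {S : Finset (Fin n)} {i : Fin n} (hi : i ∈ S) (x : Cube n) :
    cubeChar S (Function.update x i !(x i)) = -cubeChar S x := by
  rw [cubeChar, cubeChar, ← Finset.mul_prod_erase S _ hi, ← Finset.mul_prod_erase S _ hi,
    ← neg_mul]
  congr 1
  · cases h : x i <;> simp
  · exact Finset.prod_congr rfl fun j hj => by
      rw [Function.update_of_ne (Finset.ne_of_mem_erase hj)]

theorem expect_cubeChar (S : Finset (Fin n)) : 𝔼 x, cubeChar S x = if S = ∅ then 1 else 0 := by
  split_ifs with hS
  · subst hS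
    simp [cubeChar]
  · obtain ⟨i, hi⟩ := Finset.nonempty_iff_ne_empty.mpr hS
    have hflip : Function.Involutive fun x : Cube n => Function.update x i !(x i) := fun x => by
      simp
    have hneg : 𝔼 x, cubeChar S x = -𝔼 x, cubeChar S x := by
      rw [← Finset.expect_neg_distrib]
      exact Fintype.expect_equiv hflip.toPerm _ _ fun x => by simp [cubeChar_flip hi]
    linarith

theorem expect_cubeChar_mul_cubeChar (S T : Finset (Fin n)) :
    𝔼 x, cubeChar S x * cubeChar T x = if S = T then 1 else 0 := by
  simp only [cubeChar_mul_cubeChar, expect_cubeChar, ← Finset.bot_eq_empty, symmDiff_eq_bot]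

theorem sum_cubeChar_mul_cubeChar (x y : Cube n) :
    ∑ S, cubeChar S x * cubeChar S y = if x = y then (2 : ℝ) ^ n else 0 := by
  have hprod := Finset.prod_one_add (R := ℝ) (s := (Finset.univ : Finset (Fin n)))
    (f := fun i => (if x i then 1 else -1) * (if y i then 1 else -1))
  rw [Finset.powerset_univ] at hprod
  simp only [cubeChar, ← Finset.prod_mul_distrib, ← hprod]
  split_ifs with hxy
  · subst hxy
    rw [Finset.prod_congr rfl fun i _ => show _ = (2 : ℝ) by split_ifs <;> norm_num]
    simp
  · obtain ⟨i, hi⟩ := Function.ne_iff.mp hxy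
    refine Finset.prod_eq_zero (Finset.mem_univ i) ?_
    cases hx : x i <;> cases hy : y i <;> simp_all

theorem fourierCoefficient_eq_expect (f : Cube n → ℝ) (S : Finset (Fin n)) :
    fourierCoefficient f S = 𝔼 x, f x * cubeChar S x := by
  rw [fourierCoefficient, Fintype.expect_eq_sum_div_card]
  simp

theorem fourier_inversion (f : Cube n → ℝ) (x : Cube n) :
    f x = ∑ S, fourierCoefficient f S * cubeChar S x := by
  symm
  calc ∑ S, fourierCoefficient f S * cubeChar S x
      = (∑ y, f y * ∑ S, cubeChar S y * cubeChar S x) / 2 ^ n := by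
        simp only [fourierCoefficient, Finset.sum_div, Finset.sum_mul, Finset.mul_sum]
        rw [Finset.sum_comm]
        exact Finset.sum_congr rfl fun _ _ => Finset.sum_congr rfl fun _ _ => by ring
    _ = f x := by simp [sum_cubeChar_mul_cubeChar]

theorem expect_sq_sum_mul_cubeChar (s : Finset (Finset (Fin n))) (a : Finset (Fin n) → ℝ) :
    𝔼 x, (∑ S ∈ s, a S * cubeChar S x) ^ 2 = ∑ S ∈ s, a S ^ 2 := by
  calc 𝔼 x, (∑ S ∈ s, a S * cubeChar S x) ^ 2
      = ∑ S ∈ s, ∑ T ∈ s, a S * a T * 𝔼 x, cubeChar S x * cubeChar T x := by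
        simp only [sq, Finset.sum_mul_sum, Finset.expect_sum_comm, Finset.mul_expect]
        exact Finset.sum_congr rfl fun _ _ => Finset.sum_congr rfl fun _ _ =>
          Finset.expect_congr rfl fun _ _ => by ring
    _ = ∑ S ∈ s, a S ^ 2 := by
        simp only [expect_cubeChar_mul_cubeChar, mul_ite, mul_one, mul_zero, Finset.sum_ite_eq]
        exact Finset.sum_congr rfl fun S hS => by rw [if_pos hS, sq]

theorem parseval (f : Cube n → ℝ) : 𝔼 x, f x ^ 2 = ∑ S, fourierCoefficient f S ^ 2 := by
  rw [← expect_sq_sum_mul_cubeChar]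
  simp only [← fourier_inversion]

/-- The orthogonal projection of `f` to the span of the characters `χ_S` with `S ∈ s`. -/
noncomputable def fourierProj (s : Finset (Finset (Fin n))) (f : Cube n → ℝ) : Cube n → ℝ :=
  fun x => ∑ S ∈ s, fourierCoefficient f S * cubeChar S x

theorem expect_sq_fourierProj (s : Finset (Finset (Fin n))) (f : Cube n → ℝ) :
    𝔼 x, fourierProj s f x ^ 2 = ∑ S ∈ s, fourierCoefficient f S ^ 2 :=
  expect_sq_sum_mul_cubeChar s _

theorem fourierProj_compl_add_fourierProj (s : Finset (Finset (Fin n))) (f : Cube n → ℝ) :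
    fourierProj sᶜ f + fourierProj s f = f := by
  ext x
  rw [Pi.add_apply, fourierProj, fourierProj, Finset.sum_compl_add_sum, ← fourier_inversion]

end Fourier

section Degree

variable {n d : ℕ}

theorem mem_sosSubspace_iff {f : Cube n → ℝ} :
    f ∈ sosSubspace n d ↔ ∀ S : Finset (Fin n), d < 2 * S.card → fourierCoefficient f S = 0 := by
  calc f ∈ sosSubspace n d ↔ 2 * cubeDegree f ≤ d := Iff.rfl
    _ ↔ cubeDegree f ≤ d / 2 := by omega
    _ ↔ _ := by
      rw [cubeDegree_le_iff]
      exact forall_congr' fun S => by rw [show d / 2 < S.card ↔ d < 2 * S.card by omega]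

theorem cubeChar_mem_sosSubspace {S : Finset (Fin n)} (hS : 2 * S.card ≤ d) :
    cubeChar S ∈ sosSubspace n d := by
  rw [mem_sosSubspace_iff]
  intro T hT
  rw [fourierCoefficient_eq_expect, expect_cubeChar_mul_cubeChar, if_neg]
  rintro rfl
  omega

theorem sosSubspace_eq_span :
    sosSubspace n d = Submodule.span ℝ (cubeChar '' {S : Finset (Fin n) | 2 * S.card ≤ d}) := by
  apply le_antisymm
  · intro f hf
    have hsum : f = ∑ S, fourierCoefficient f S • cubeChar S := by
      ext x
      simpa using fourier_inversion f x
    rw [hsum]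
    refine Submodule.sum_mem _ fun S _ => ?_
    by_cases hS : 2 * S.card ≤ d
    · exact Submodule.smul_mem _ _ (Submodule.subset_span ⟨S, hS, rfl⟩)
    · rw [mem_sosSubspace_iff.mp hf S (by omega), zero_smul]
      exact Submodule.zero_mem _
  · rw [Submodule.span_le]
    rintro _ ⟨S, hS, rfl⟩
    exact cubeChar_mem_sosSubspace hS

theorem mul_mem_sosSubspace {a b : ℕ} {f g : Cube n → ℝ} (hf : f ∈ sosSubspace n a)
    (hg : g ∈ sosSubspace n b) : f * g ∈ sosSubspace n (a + b) := by
  rw [sosSubspace_eq_span] at hf hg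
  have hfg := Submodule.mul_mem_mul hf hg
  rw [Submodule.span_mul_span] at hfg
  refine Submodule.span_le.mpr ?_ hfg
  rintro _ ⟨_, ⟨S, hS, rfl⟩, _, ⟨T, hT, rfl⟩, rfl⟩
  have hmul : cubeChar S * cubeChar T = cubeChar (symmDiff S T) :=
    funext (cubeChar_mul_cubeChar S T)
  have hcard : (symmDiff S T).card ≤ S.card + T.card :=
    (Finset.card_le_card symmDiff_le_sup).trans (Finset.card_union_le S T)
  simp only [Set.mem_ofPred_eq] at hS hT
  simp only [hmul]
  exact cubeChar_mem_sosSubspace (by omega)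

theorem const_mem_sosSubspace (a : ℝ) : (fun _ => a) ∈ sosSubspace n d := by
  have hconst : (fun _ => a) = a • (cubeChar ∅ : Cube n → ℝ) := by
    ext x
    simp [cubeChar]
  rw [hconst]
  exact Submodule.smul_mem _ _ (cubeChar_mem_sosSubspace (by simp))

theorem sosSubspace_eq_top (hd : 2 * n ≤ d) : sosSubspace n d = ⊤ := by
  refine eq_top_iff.mpr fun f _ => mem_sosSubspace_iff.mpr fun S hS => ?_
  have hcard := Finset.card_le_univ S
  rw [Fintype.card_fin] at hcard
  omega

end Degree

section Restriction

open scoped BigOperators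

variable {m n : ℕ} (σ : Fin m ↪ Fin n)

theorem cubeChar_comp (S : Finset (Fin m)) (x : Cube n) :
    cubeChar S (x ∘ σ) = cubeChar (S.map σ) x := by
  simp [cubeChar]

theorem cubeChar_extend (A : Finset (Fin n)) (y : Cube m) (x : Cube n) :
    cubeChar A (Function.extend σ y x) =
      cubeChar (A.filter (· ∉ Set.range σ)) x *
        cubeChar (A.preimage σ σ.injective.injOn) y := by
  classical
  simp only [cubeChar]
  rw [← Finset.prod_filter_mul_prod_filter_not A (· ∉ Set.range σ)]
  congr 1
  · refine Finset.prod_congr rfl fun j hj => ?_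
    rw [Function.extend_apply' _ _ _ (by simpa using (Finset.mem_filter.mp hj).2)]
  · simp only [not_not]
    rw [← Finset.prod_preimage' σ A σ.injective.injOn]
    simp only [σ.injective.extend_apply]

theorem comp_mem_sosSubspace {d : ℕ} {f : Cube m → ℝ} (hf : f ∈ sosSubspace m d) :
    (fun x : Cube n => f (x ∘ σ)) ∈ sosSubspace n d := by
  suffices hle : sosSubspace m d ≤
      (sosSubspace n d).comap (LinearMap.funLeft ℝ ℝ fun x : Cube n => x ∘ σ) from hle hf
  rw [sosSubspace_eq_span, Submodule.span_le]
  rintro _ ⟨S, hS, rfl⟩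
  have hcomp : LinearMap.funLeft ℝ ℝ (fun x : Cube n => x ∘ σ) (cubeChar S) = cubeChar (S.map σ) :=
    funext fun x => cubeChar_comp σ S x
  rw [SetLike.mem_coe, Submodule.mem_comap, hcomp]
  exact cubeChar_mem_sosSubspace (by simpa using hS)

-- `(x, y) ↦ (extend σ y x, x ∘ σ)` swaps `y` with the coordinates of `x` in the range of `σ`, so it
-- is an involution of `Cube n × Cube m`.
theorem expect_expect_extend (F : Cube n → ℝ) :
    𝔼 x : Cube n, 𝔼 y : Cube m, F (Function.extend σ y x) = 𝔼 x, F x := by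
  let swap : Cube n × Cube m → Cube n × Cube m := fun p => (Function.extend σ p.2 p.1, p.1 ∘ σ)
  have hswap : Function.Involutive swap := fun p => by
    refine Prod.ext (funext fun j => ?_) (funext fun i => σ.injective.extend_apply p.2 p.1 i)
    by_cases hj : ∃ i, σ i = j
    · obtain ⟨i, rfl⟩ := hj
      exact σ.injective.extend_apply _ _ i
    · exact (Function.extend_apply' _ _ _ hj).trans (Function.extend_apply' _ _ _ hj)
  calc 𝔼 x : Cube n, 𝔼 y : Cube m, F (Function.extend σ y x)
      = 𝔼 p : Cube n × Cube m, F (swap p).1 :=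
        (Finset.expect_product' Finset.univ Finset.univ fun x y => F (Function.extend σ y x)).symm
    _ = 𝔼 p : Cube n × Cube m, F p.1 :=
        Fintype.expect_equiv hswap.toPerm _ _ fun _ => rfl
    _ = 𝔼 x, F x := by
        rw [← Finset.univ_product_univ, Finset.expect_product]
        simp

theorem expect_comp_embedding (F : Cube m → ℝ) : 𝔼 x : Cube n, F (x ∘ σ) = 𝔼 y, F y := by
  rw [← expect_expect_extend σ]
  simp [Function.comp_def, σ.injective.extend_apply]

/-- The functions on `Cube n` all of whose restrictions to the subcubes with free variables in the
range of `σ` lie in `U`. -/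
noncomputable def restrictionSubspace (U : Submodule ℝ (Cube m → ℝ)) : Submodule ℝ (Cube n → ℝ) :=
  ⨅ x : Cube n, U.comap (LinearMap.funLeft ℝ ℝ fun y => Function.extend σ y x)

theorem mem_restrictionSubspace {U : Submodule ℝ (Cube m → ℝ)} {f : Cube n → ℝ} :
    f ∈ restrictionSubspace σ U ↔ ∀ x, (fun y => f (Function.extend σ y x)) ∈ U := by
  rw [restrictionSubspace, Submodule.mem_iInf]
  rfl

/-- The sets of variables whose characters, restricted to the variables in the range of `σ`, have
degree more than `d / 2`. -/
noncomputable def highSets (d : ℕ) : Finset (Finset (Fin n)) :=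
  Finset.univ.filter fun A => d < 2 * (A.preimage σ σ.injective.injOn).card

theorem fourierProj_compl_highSets_mem (d : ℕ) (f : Cube n → ℝ) :
    fourierProj (highSets σ d)ᶜ f ∈ restrictionSubspace σ (sosSubspace m d) := by
  have hsum : fourierProj (highSets σ d)ᶜ f =
      ∑ A ∈ (highSets σ d)ᶜ, fourierCoefficient f A • cubeChar A := by
    ext x
    simp [fourierProj]
  rw [hsum]
  refine Submodule.sum_mem _ fun A hA => Submodule.smul_mem _ _ ?_
  have hlow : 2 * (A.preimage σ σ.injective.injOn).card ≤ d := by simpa [highSets] using hA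
  refine (mem_restrictionSubspace σ).mpr fun x => ?_
  simp only [cubeChar_extend]
  exact Submodule.smul_mem _ _ (cubeChar_mem_sosSubspace hlow)

end Restriction

section PseudoDensity

open scoped BigOperators

variable {m n : ℕ} {U : Submodule ℝ (Cube m → ℝ)} {D : Cube m → ℝ}

/-- The density of a pseudo-distribution that is nonnegative on squares of functions in `U`. It is
normalised by its sup norm, rather than by its mean. -/
structure IsPseudoDensity (U : Submodule ℝ (Cube m → ℝ)) (D : Cube m → ℝ) : Prop where
  abs_le_one : ∀ y, |D y| ≤ 1
  expect_mul_sq_nonneg : ∀ g ∈ U, 0 ≤ 𝔼 y, D y * g y ^ 2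

theorem IsPseudoDensity.expect_comp_mul_sq_nonneg (hD : IsPseudoDensity U D) (σ : Fin m ↪ Fin n)
    {f : Cube n → ℝ} (hf : f ∈ restrictionSubspace σ U) :
    0 ≤ 𝔼 x : Cube n, D (x ∘ σ) * f x ^ 2 := by
  rw [← expect_expect_extend σ]
  simp only [Function.comp_def, σ.injective.extend_apply]
  exact Finset.expect_nonneg fun x _ =>
    hD.expect_mul_sq_nonneg _ ((mem_restrictionSubspace σ).mp hf x)

-- Weighted AM-GM for the cross term of `h ^ 2 - (h - u) ^ 2 = 2 * h * u - u ^ 2`.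
theorem abs_sq_sub_sq_sub_le {θ : ℝ} (hθ : 0 < θ) (h u : ℝ) :
    |h ^ 2 - (h - u) ^ 2| ≤ θ * h ^ 2 + (1 + 1 / θ) * u ^ 2 := by
  have hsq : 0 ≤ (θ * h - u) ^ 2 / θ ∧ 0 ≤ (θ * h + u) ^ 2 / θ := by
    constructor <;> positivity
  have hexp : (θ * h - u) ^ 2 / θ = θ * h ^ 2 - 2 * h * u + 1 / θ * u ^ 2 ∧
      (θ * h + u) ^ 2 / θ = θ * h ^ 2 + 2 * h * u + 1 / θ * u ^ 2 := by
    constructor <;> field_simp <;> ring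
  rw [abs_le]
  constructor <;> nlinarith [sq_nonneg u]

theorem IsPseudoDensity.expect_comp_mul_sq_ge (hD : IsPseudoDensity U D) (σ : Fin m ↪ Fin n)
    {θ : ℝ} (hθ : 0 < θ) {l u : Cube n → ℝ} (hl : l ∈ restrictionSubspace σ U) :
    -(θ * 𝔼 x, (l x + u x) ^ 2 + (1 + 1 / θ) * 𝔼 x, u x ^ 2) ≤
      𝔼 x, D (x ∘ σ) * (l x + u x) ^ 2 := by
  have hpointwise : ∀ x, D (x ∘ σ) * l x ^ 2 - (θ * (l x + u x) ^ 2 + (1 + 1 / θ) * u x ^ 2) ≤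
      D (x ∘ σ) * (l x + u x) ^ 2 := fun x => by
    have hdiff := abs_sq_sub_sq_sub_le hθ (l x + u x) (u x)
    have hprod : |D (x ∘ σ) * ((l x + u x) ^ 2 - (l x + u x - u x) ^ 2)| ≤
        θ * (l x + u x) ^ 2 + (1 + 1 / θ) * u x ^ 2 := by
      rw [abs_mul]
      exact (mul_le_of_le_one_left (abs_nonneg _) (hD.abs_le_one _)).trans hdiff
    rw [add_sub_cancel_right, mul_sub] at hprod
    linarith [neg_le_of_abs_le hprod]
  have hexpect := Finset.expect_le_expect fun x (_ : x ∈ Finset.univ) => hpointwise x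
  simp only [Finset.expect_sub_distrib, Finset.expect_add_distrib, ← Finset.mul_expect] at hexpect
  linarith [hD.expect_comp_mul_sq_nonneg σ hl]

end PseudoDensity

section Trace

open Matrix
open scoped BigOperators MatrixOrder NNRat

variable {ι κ μ : Type*} [Fintype ι] [Fintype κ] [Fintype μ]

theorem trace_expect {α : Type*} (s : Finset α) (A : α → Matrix ι ι ℝ) :
    (𝔼 i ∈ s, A i).trace = 𝔼 i ∈ s, (A i).trace :=
  map_expect (traceLinearMap ι ℚ≥0 ℝ) A s

theorem trace_le_trace {A B : Matrix ι ι ℝ} (hAB : A ≤ B) : A.trace ≤ B.trace := by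
  have htrace := PosSemidef.trace_nonneg (le_iff.mp hAB)
  rwa [trace_sub, sub_nonneg] at htrace

theorem trace_mul_conjTranspose_self_eq_sum (R : Matrix ι κ ℝ) :
    (R * Rᴴ).trace = ∑ i, ∑ j, R i j ^ 2 := by
  simp [trace, Matrix.mul_apply, sq]

theorem trace_conjTranspose_mul_self_mul_mul_conjTranspose (G : Matrix μ ι ℝ)
    (R : Matrix ι κ ℝ) :
    (Gᴴ * G * (R * Rᴴ)).trace = ∑ i, ∑ j, (G * R) i j ^ 2 := by
  rw [← trace_mul_conjTranspose_self_eq_sum, conjTranspose_mul, Matrix.mul_assoc, trace_mul_comm]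
  simp only [Matrix.mul_assoc]

theorem trace_mul_nonneg {P Q : Matrix ι ι ℝ} (hP : 0 ≤ P) (hQ : 0 ≤ Q) : 0 ≤ (P * Q).trace := by
  classical
  obtain ⟨G, rfl⟩ := CStarAlgebra.nonneg_iff_eq_star_mul_self.mp hP
  rw [Matrix.mul_assoc, trace_mul_comm]
  exact ((nonneg_iff_posSemidef.mp hQ).mul_mul_conjTranspose_same G).trace_nonneg

theorem trace_mul_le_trace_mul {P P' Q : Matrix ι ι ℝ} (hP : P ≤ P') (hQ : 0 ≤ Q) :
    (P * Q).trace ≤ (P' * Q).trace := by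
  have htrace := trace_mul_nonneg (sub_nonneg.mpr hP) hQ
  rwa [Matrix.sub_mul, trace_sub, sub_nonneg] at htrace

theorem le_trace_smul_one [DecidableEq ι] {P : Matrix ι ι ℝ} (hP : 0 ≤ P) : P ≤ P.trace • 1 := by
  have hpsd := nonneg_iff_posSemidef.mp hP
  rw [← Algebra.algebraMap_eq_smul_one]
  refine le_algebraMap_of_spectrum_le fun a ha => ?_
  rw [hpsd.1.spectrum_real_eq_range_eigenvalues] at ha
  obtain ⟨i, rfl⟩ := ha
  rw [hpsd.1.trace_eq_sum_eigenvalues]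
  exact Finset.single_le_sum (fun j _ => hpsd.eigenvalues_nonneg j) (Finset.mem_univ i)

end Trace

section Cones

open Matrix
open scoped BigOperators

/-- The cone of the functions `x ↦ Tr(P Q(x))` with `P` positive semidefinite. -/
def psdCone {ι κ : Type*} [Fintype ι] (Q : κ → Matrix ι ι ℝ) : PointedCone ℝ (κ → ℝ) where
  carrier := {f | ∃ P : Matrix ι ι ℝ, P.PosSemidef ∧ f = fun x => (P * Q x).trace}
  zero_mem' := ⟨0, PosSemidef.zero, by ext; simp⟩
  add_mem' := by
    rintro _ _ ⟨P, hP, rfl⟩ ⟨P', hP', rfl⟩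
    exact ⟨P + P', hP.add hP', by ext; simp [Matrix.add_mul, trace_add]⟩
  smul_mem' := by
    rintro a _ ⟨P, hP, rfl⟩
    exact ⟨(a : ℝ) • P, hP.smul a.2, by ext; simp [trace_smul]⟩

/-- The cone of the sums of a function in `psdCone Q` and a nonnegative constant. -/
def psdConstCone {ι κ : Type*} [Fintype ι] (Q : κ → Matrix ι ι ℝ) : PointedCone ℝ (κ → ℝ) :=
  psdCone Q ⊔ PointedCone.hull ℝ {1}

theorem mem_psdConstCone {ι κ : Type*} [Fintype ι] {Q : κ → Matrix ι ι ℝ} {f : κ → ℝ} :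
    f ∈ psdConstCone Q ↔
      ∃ P : Matrix ι ι ℝ, P.PosSemidef ∧ ∃ b : ℝ, 0 ≤ b ∧ ∀ x, f x = (P * Q x).trace + b := by
  rw [psdConstCone, Submodule.mem_sup]
  constructor
  · rintro ⟨_, ⟨P, hP, rfl⟩, _, hb, rfl⟩
    obtain ⟨b, rfl⟩ := Submodule.mem_span_singleton.mp hb
    exact ⟨P, hP, b, b.2, fun x => congrArg _ (mul_one (b : ℝ))⟩
  · rintro ⟨P, hP, b, hb, hf⟩
    refine ⟨_, ⟨P, hP, rfl⟩, _, Submodule.mem_span_singleton.mpr ⟨⟨b, hb⟩, rfl⟩, ?_⟩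
    ext x
    exact (congrArg _ (mul_one b)).trans (hf x).symm

theorem exists_dotProduct_separating {κ : Type*} [Fintype κ] {K : PointedCone ℝ (κ → ℝ)}
    {p : κ → ℝ} (hp : p ∉ closure (K : Set (κ → ℝ))) :
    ∃ μ : κ → ℝ, (∀ q ∈ K, 0 ≤ μ ⬝ᵥ q) ∧ μ ⬝ᵥ p < 0 := by
  classical
  obtain ⟨φ, hφ, hφp⟩ := ProperCone.hyperplane_separation_point
    (⟨K.closure, isClosed_closure⟩ : ProperCone ℝ (κ → ℝ)) (x₀ := p) hp
  have hrepr : ∀ q, φ q = (fun i => φ (Pi.single i 1)) ⬝ᵥ q := fun q => by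
    conv_lhs => rw [pi_eq_sum_univ' q]
    simp [dotProduct, mul_comm]
  exact ⟨_, fun q hq => (hφ q (subset_closure hq)).trans_eq (hrepr q), by rwa [← hrepr]⟩

end Cones

section SumsOfSquares

open Matrix
open scoped BigOperators

variable {n : ℕ} (U : Submodule ℝ (Cube n → ℝ))

/-- The outer products `w(x) w(x)ᵀ` of the coordinates `w(x)` of the evaluation at `x` in a basis
of `U`. Pairing them with positive semidefinite matrices gives the sums of squares from `U`. -/
noncomputable def basisGram (x : Cube n) :
    Matrix (Fin (Module.finrank ℝ U)) (Fin (Module.finrank ℝ U)) ℝ :=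
  vecMulVec (fun i => (Module.finBasis ℝ U i : Cube n → ℝ) x)
    fun i => (Module.finBasis ℝ U i : Cube n → ℝ) x

theorem posSemidef_basisGram (x : Cube n) : (basisGram U x).PosSemidef :=
  posSemidef_vecMulVec_self_star _

theorem trace_mul_basisGram {κ : Type*} [Fintype κ]
    (G : Matrix κ (Fin (Module.finrank ℝ U)) ℝ) (x : Cube n) :
    (Gᴴ * G * basisGram U x).trace =
      ∑ a, (∑ i, G a i • (Module.finBasis ℝ U i : Cube n → ℝ)) x ^ 2 := by
  rw [basisGram, mul_vecMulVec, trace_vecMulVec, ← mulVec_mulVec, dotProduct_comm,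
    dotProduct_mulVec, vecMul_conjTranspose]
  simp [dotProduct, mulVec, sq]

variable {U} {f : Cube n → ℝ}

theorem IsSumSqOf.mem_psdCone (hf : IsSumSqOf U f) : f ∈ psdCone (basisGram U) := by
  obtain ⟨t, g, hg, hf⟩ := hf
  let G : Matrix (Fin t) (Fin (Module.finrank ℝ U)) ℝ :=
    of fun a i => (Module.finBasis ℝ U).repr ⟨g a, hg a⟩ i
  have hrepr : ∀ a, ∑ i, G a i • (Module.finBasis ℝ U i : Cube n → ℝ) = g a := fun a => by
    simpa only [G, of_apply, Submodule.coe_sum, Submodule.coe_smul] using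
      congrArg Subtype.val ((Module.finBasis ℝ U).sum_repr ⟨g a, hg a⟩)
  refine ⟨Gᴴ * G, posSemidef_conjTranspose_mul_self G, funext fun x => ?_⟩
  simp only [hf x, trace_mul_basisGram, hrepr]

theorem exists_eq_sum_sq_of_mem_psdCone (hf : f ∈ psdCone (basisGram U)) :
    ∃ g : Fin (Module.finrank ℝ U) → U, ∀ x, f x = ∑ a, (g a : Cube n → ℝ) x ^ 2 := by
  obtain ⟨P, hP, rfl⟩ := hf
  open scoped MatrixOrder in
  obtain ⟨G, rfl⟩ := CStarAlgebra.nonneg_iff_eq_star_mul_self.mp hP.nonneg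
  refine ⟨fun a => ∑ i, G a i • Module.finBasis ℝ U i, fun x => ?_⟩
  simp only [star_eq_conjTranspose, trace_mul_basisGram]
  simp only [Submodule.coe_sum, Submodule.coe_smul]

theorem isSumSqOf_iff_mem_psdCone : IsSumSqOf U f ↔ f ∈ psdCone (basisGram U) := by
  refine ⟨IsSumSqOf.mem_psdCone, fun hf => ?_⟩
  obtain ⟨g, hg⟩ := exists_eq_sum_sq_of_mem_psdCone hf
  exact ⟨_, fun a => g a, fun a => (g a).2, hg⟩

theorem isSumSqOf_sq (hf : f ∈ U) : IsSumSqOf U (f ^ 2) :=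
  ⟨1, fun _ => f, fun _ => hf, fun x => by simp⟩

-- The map `g ↦ ∑ a, g a ^ 2` on families of the fixed length `dim U` is proper, since `‖g‖ ^ 2` is
-- at most the norm of its image; so its range is closed.
theorem isClosed_psdCone_basisGram (U : Submodule ℝ (Cube n → ℝ)) :
    IsClosed (psdCone (basisGram U) : Set (Cube n → ℝ)) := by
  let sumSq : (Fin (Module.finrank ℝ U) → U) → Cube n → ℝ :=
    fun g x => ∑ a, (g a : Cube n → ℝ) x ^ 2
  have hcont : Continuous sumSq := by
    refine continuous_pi fun x => continuous_finsetSum _ fun a _ => ?_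
    exact ((continuous_apply x).comp (continuous_subtype_val.comp (continuous_apply a))).pow 2
  have hnorm : ∀ g, ‖g‖ ^ 2 ≤ ‖sumSq g‖ := fun g => by
    have hentry : ∀ a x, (g a : Cube n → ℝ) x ^ 2 ≤ ‖sumSq g‖ := fun a x =>
      calc (g a : Cube n → ℝ) x ^ 2 ≤ sumSq g x :=
            Finset.single_le_sum (f := fun a => (g a : Cube n → ℝ) x ^ 2)
              (fun b _ => sq_nonneg _) (Finset.mem_univ a)
        _ ≤ ‖sumSq g‖ := (Real.le_norm_self _).trans (norm_le_pi_norm _ x)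
    rw [← Real.le_sqrt (norm_nonneg g) (norm_nonneg _),
      pi_norm_le_iff_of_nonneg (Real.sqrt_nonneg _)]
    exact fun a => (pi_norm_le_iff_of_nonneg (Real.sqrt_nonneg _)).mpr fun x =>
      Real.abs_le_sqrt (hentry a x)
  have hproper : IsProperMap sumSq := by
    refine isProperMap_iff_tendsto_cocompact.mpr ⟨hcont, ?_⟩
    rw [← Metric.cobounded_eq_cocompact, ← Metric.cobounded_eq_cocompact,
      ← tendsto_norm_atTop_iff_cobounded]
    exact Filter.tendsto_atTop_mono hnorm
      ((Filter.tendsto_pow_atTop two_ne_zero).comp tendsto_norm_cobounded_atTop)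
  have hrange : (psdCone (basisGram U) : Set (Cube n → ℝ)) = Set.range sumSq := by
    ext f
    constructor
    · intro hf
      obtain ⟨g, hg⟩ := exists_eq_sum_sq_of_mem_psdCone hf
      exact ⟨g, funext fun x => (hg x).symm⟩
    · rintro ⟨g, rfl⟩
      exact IsSumSqOf.mem_psdCone ⟨_, fun a => g a, fun a => (g a).2, fun _ => rfl⟩
  exact hrange ▸ hproper.isClosedMap.isClosed_range

open scoped BigOperators in
theorem exists_isPseudoDensity_of_not_isSumSqOf (hf : ¬ IsSumSqOf U f) :
    ∃ D, IsPseudoDensity U D ∧ 𝔼 x, D x * f x < 0 := by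
  rw [isSumSqOf_iff_mem_psdCone, ← SetLike.mem_coe, ← (isClosed_psdCone_basisGram U).closure_eq]
    at hf
  obtain ⟨μ, hμ, hμf⟩ := exists_dotProduct_separating hf
  have hμ0 : 0 < ‖μ‖ := norm_pos_iff.mpr fun h => by simp [h] at hμf
  have hexpect : ∀ g : Cube n → ℝ, 𝔼 x, (‖μ‖⁻¹ • μ) x * g x = μ ⬝ᵥ g / (‖μ‖ * 2 ^ n) := fun g => by
    rw [Fintype.expect_eq_sum_div_card]
    simp only [Pi.smul_apply, smul_eq_mul, mul_assoc, ← Finset.mul_sum, dotProduct]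
    simp
    field_simp
  refine ⟨‖μ‖⁻¹ • μ, ⟨fun y => ?_, fun g hg => ?_⟩, ?_⟩
  · rw [Pi.smul_apply, smul_eq_mul, abs_mul, abs_inv, abs_norm, inv_mul_le_one₀ hμ0]
    exact norm_le_pi_norm μ y
  · exact (hexpect (g ^ 2)).symm ▸
      div_nonneg (hμ _ (isSumSqOf_sq hg).mem_psdCone) (by positivity)
  · exact (hexpect f).symm ▸ div_neg_of_neg_of_pos hμf (by positivity)

end SumsOfSquares

section Spread

open Matrix
open scoped BigOperators MatrixOrder

variable {m n : ℕ} {Ω ι : Type*} [Fintype Ω] [Fintype ι]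

/-- For `ω` uniform in `Ω`, each fixed set of at most `a` variables meets the range of the random
embedding `τ ω` in more than `d / 2` variables with probability at most `p`. -/
def IsSpread (τ : Ω → Fin m ↪ Fin n) (a d : ℕ) (p : ℝ) : Prop :=
  ∀ A : Finset (Fin n), A.card ≤ a → 𝔼 ω, (if A ∈ highSets (τ ω) d then (1 : ℝ) else 0) ≤ p

theorem IsSpread.expect_expect_sq_fourierProj_le {τ : Ω → Fin m ↪ Fin n} {a d : ℕ} {p : ℝ}
    (hτ : IsSpread τ a d p) {f : Cube n → ℝ} (hf : f ∈ sosSubspace n (2 * a)) :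
    𝔼 ω, 𝔼 x, fourierProj (highSets (τ ω) d) f x ^ 2 ≤ p * 𝔼 x, f x ^ 2 := by
  calc 𝔼 ω, 𝔼 x, fourierProj (highSets (τ ω) d) f x ^ 2
      = ∑ A, (𝔼 ω, if A ∈ highSets (τ ω) d then (1 : ℝ) else 0) * fourierCoefficient f A ^ 2 := by
        simp only [expect_sq_fourierProj, Finset.expect_mul, ite_mul, one_mul, zero_mul,
          ← Finset.expect_sum_comm, Finset.sum_ite_mem, Finset.univ_inter]
    _ ≤ ∑ A, p * fourierCoefficient f A ^ 2 := by
        refine Finset.sum_le_sum fun A _ => ?_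
        by_cases hA : A.card ≤ a
        · exact mul_le_mul_of_nonneg_right (hτ A hA) (sq_nonneg _)
        · simp [mem_sosSubspace_iff.mp hf A (by omega)]
    _ = p * 𝔼 x, f x ^ 2 := by rw [parseval, Finset.mul_sum]

/-- The average over `ω` of the lifts of the pseudo-density `D` along the embeddings `τ ω`, weighted
by the matrices `P ω`. -/
noncomputable def pseudoOperator (D : Cube m → ℝ) (τ : Ω → Fin m ↪ Fin n) (P : Ω → Matrix ι ι ℝ)
    (x : Cube n) : Matrix ι ι ℝ :=
  𝔼 ω, D (x ∘ τ ω) • P ω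

theorem trace_pseudoOperator_mul (D : Cube m → ℝ) (τ : Ω → Fin m ↪ Fin n)
    (P : Ω → Matrix ι ι ℝ) (x : Cube n) (Q : Matrix ι ι ℝ) :
    (pseudoOperator D τ P x * Q).trace = 𝔼 ω, D (x ∘ τ ω) * (P ω * Q).trace := by
  classical
  simp only [pseudoOperator, Finset.expect_mul, trace_expect, Matrix.smul_mul, trace_smul,
    smul_eq_mul]

variable [DecidableEq ι]

theorem IsPseudoDensity.expect_comp_mul_trace_ge {U : Submodule ℝ (Cube m → ℝ)} {D : Cube m → ℝ}
    (hD : IsPseudoDensity U D) (σ : Fin m ↪ Fin n) {θ K : ℝ} (hθ : 0 < θ) {P : Matrix ι ι ℝ}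
    (hP : 0 ≤ P) (hPK : P ≤ K • 1) {L V : Cube n → Matrix ι ι ℝ}
    (hL : ∀ i j, (fun x => L x i j) ∈ restrictionSubspace σ U) :
    -(θ * 𝔼 x, (P * ((L x + V x) * (L x + V x)ᴴ)).trace +
        (1 + 1 / θ) * K * 𝔼 x, (V x * (V x)ᴴ).trace) ≤
      𝔼 x, D (x ∘ σ) * (P * ((L x + V x) * (L x + V x)ᴴ)).trace := by
  have hV : 𝔼 x, (P * (V x * (V x)ᴴ)).trace ≤ K * 𝔼 x, (V x * (V x)ᴴ).trace := by
    rw [Finset.mul_expect]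
    refine Finset.expect_le_expect fun x _ => ?_
    have htrace := trace_mul_le_trace_mul hPK (mul_star_self_nonneg (V x))
    rwa [Matrix.smul_mul, Matrix.one_mul, trace_smul] at htrace
  obtain ⟨G, rfl⟩ := CStarAlgebra.nonneg_iff_eq_star_mul_self.mp hP
  simp only [star_eq_conjTranspose, trace_conjTranspose_mul_self_mul_mul_conjTranspose,
    Matrix.mul_add, Matrix.add_apply] at hV ⊢
  have hentry : ∀ i j, (fun x => (G * L x) i j) ∈ restrictionSubspace σ U := fun i j => by
    have hsum : (fun x => (G * L x) i j) = ∑ b, G i b • fun x => L x b j := by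
      ext x
      simp [Matrix.mul_apply]
    exact hsum ▸ Submodule.sum_mem _ fun b _ => Submodule.smul_mem _ _ (hL b j)
  have hsum := Finset.sum_le_sum fun i (_ : i ∈ Finset.univ) => Finset.sum_le_sum
    fun j (_ : j ∈ Finset.univ) => hD.expect_comp_mul_sq_ge σ hθ (u := fun x => (G * V x) i j)
      (hentry i j)
  simp only [Finset.sum_neg_distrib, Finset.sum_add_distrib, ← Finset.mul_sum,
    ← Finset.expect_sum_comm] at hsum
  have hscale := mul_le_mul_of_nonneg_left hV (by positivity : 0 ≤ 1 + 1 / θ)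
  rw [← mul_assoc] at hscale
  linarith

theorem IsPseudoDensity.expect_trace_pseudoOperator_mul_ge {a d : ℕ} {D : Cube m → ℝ}
    (hD : IsPseudoDensity (sosSubspace m d) D) {τ : Ω → Fin m ↪ Fin n} {p : ℝ}
    (hτ : IsSpread τ a d p) {P : Ω → Matrix ι ι ℝ} (hP : ∀ ω, 0 ≤ P ω) (hP1 : 𝔼 ω, P ω ≤ 1)
    {K θ : ℝ} (hK : 0 ≤ K) (hPK : ∀ ω, P ω ≤ K • 1) (hθ : 0 < θ) {R : Cube n → Matrix ι ι ℝ}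
    (hR : ∀ i j, (fun x => R x i j) ∈ sosSubspace n (2 * a)) :
    -((θ + (1 + 1 / θ) * K * p) * 𝔼 x, (R x * (R x)ᴴ).trace) ≤
      𝔼 x, (pseudoOperator D τ P x * (R x * (R x)ᴴ)).trace := by
  let L : Ω → Cube n → Matrix ι ι ℝ := fun ω x =>
    of fun i j => fourierProj (highSets (τ ω) d)ᶜ (fun x => R x i j) x
  let V : Ω → Cube n → Matrix ι ι ℝ := fun ω x =>
    of fun i j => fourierProj (highSets (τ ω) d) (fun x => R x i j) x
  have hLV : ∀ ω x, L ω x + V ω x = R x := fun ω x => by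
    ext i j
    exact congrFun (fourierProj_compl_add_fourierProj (highSets (τ ω) d) fun x => R x i j) x
  have hV : 𝔼 ω, 𝔼 x, (V ω x * (V ω x)ᴴ).trace ≤ p * 𝔼 x, (R x * (R x)ᴴ).trace := by
    simp only [trace_mul_conjTranspose_self_eq_sum, Finset.expect_sum_comm, Finset.mul_sum]
    exact Finset.sum_le_sum fun i _ => Finset.sum_le_sum fun j _ =>
      hτ.expect_expect_sq_fourierProj_le (hR i j)
  have hmean : 𝔼 ω, 𝔼 x, (P ω * (R x * (R x)ᴴ)).trace ≤ 𝔼 x, (R x * (R x)ᴴ).trace := by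
    rw [Finset.expect_comm]
    refine Finset.expect_le_expect fun x _ => ?_
    rw [← trace_expect, ← Finset.expect_mul]
    have htrace := trace_mul_le_trace_mul hP1 (mul_star_self_nonneg (R x))
    rwa [Matrix.one_mul] at htrace
  have hbound := Finset.expect_le_expect fun ω (_ : ω ∈ Finset.univ) =>
    hD.expect_comp_mul_trace_ge (τ ω) hθ (hP ω) (hPK ω) (L := L ω) (V := V ω)
      fun i j => fourierProj_compl_highSets_mem (τ ω) d _
  simp only [hLV, Finset.expect_neg_distrib, Finset.expect_add_distrib, ← Finset.mul_expect]
    at hbound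
  simp only [trace_pseudoOperator_mul]
  rw [Finset.expect_comm]
  have hVscale := mul_le_mul_of_nonneg_left hV (by positivity : 0 ≤ (1 + 1 / θ) * K)
  have hmeanscale := mul_le_mul_of_nonneg_left hmean hθ.le
  linarith

end Spread

section Blocks

open scoped BigOperators

theorem expect_prod_apply {ι β : Type*} [Fintype ι] [DecidableEq ι] [Fintype β] (f : ι → β → ℝ) :
    𝔼 ω : ι → β, ∏ i, f i (ω i) = ∏ i, 𝔼 b, f i b := by
  simp [Fintype.expect_eq_sum_div_card, Finset.prod_div_distrib, Fintype.prod_sum]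

theorem expect_prod_mem_le {ι β : Type*} [Fintype ι] [DecidableEq ι] [Fintype β] [DecidableEq β]
    {S : ι → Finset β} {a : ℕ} (hS : ∀ i, (S i).card ≤ a) (J : Finset ι) :
    𝔼 ω : ι → β, ∏ i ∈ J, (if ω i ∈ S i then (1 : ℝ) else 0) ≤
      ((a : ℝ) / Fintype.card β) ^ J.card := by
  calc 𝔼 ω : ι → β, ∏ i ∈ J, (if ω i ∈ S i then (1 : ℝ) else 0)
      = ∏ i, 𝔼 b, if i ∈ J then (if b ∈ S i then (1 : ℝ) else 0) else 1 := by
        rw [← expect_prod_apply]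
        simp only [Finset.prod_ite_mem, Finset.univ_inter]
    _ ≤ ∏ i, if i ∈ J then (a : ℝ) / Fintype.card β else 1 := by
        refine Finset.prod_le_prod (fun i _ => Finset.expect_nonneg fun b _ => ?_) fun i _ => ?_
        · split_ifs <;> norm_num
        · split_ifs
          · have hcard : ((S i).card : ℝ) ≤ a := mod_cast hS i
            simpa [Fintype.expect_eq_sum_div_card] using
              div_le_div_of_nonneg_right hcard (Nat.cast_nonneg _)
          · simpa [Fintype.expect_eq_sum_div_card] using div_self_le_one (Fintype.card β : ℝ)
    _ = ((a : ℝ) / Fintype.card β) ^ J.card := by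
        rw [Finset.prod_ite_mem, Finset.univ_inter, Finset.prod_const]

theorem expect_card_filter_mem_ge_le {ι β : Type*} [Fintype ι] [DecidableEq ι] [Fintype β]
    [DecidableEq β] {S : ι → Finset β} {a : ℕ} (hS : ∀ i, (S i).card ≤ a) (t : ℕ) :
    𝔼 ω : ι → β, (if t ≤ (Finset.univ.filter fun i => ω i ∈ S i).card then (1 : ℝ) else 0) ≤
      (Fintype.card ι).choose t * ((a : ℝ) / Fintype.card β) ^ t := by
  calc 𝔼 ω : ι → β, (if t ≤ (Finset.univ.filter fun i => ω i ∈ S i).card then (1 : ℝ) else 0)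
      ≤ 𝔼 ω : ι → β, ∑ J ∈ Finset.univ.powersetCard t,
          ∏ i ∈ J, (if ω i ∈ S i then (1 : ℝ) else 0) := by
        refine Finset.expect_le_expect fun ω _ => ?_
        have hnonneg : ∀ J ∈ Finset.univ.powersetCard t,
            0 ≤ ∏ i ∈ J, (if ω i ∈ S i then (1 : ℝ) else 0) := fun J _ =>
          Finset.prod_nonneg fun i _ => by positivity
        split_ifs with ht
        · obtain ⟨J, hJ, hcard⟩ := Finset.exists_subset_card_eq ht
          refine le_trans (Eq.ge ?_) (Finset.single_le_sum hnonneg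
            (Finset.mem_powersetCard.mpr ⟨J.subset_univ, hcard⟩))
          exact Finset.prod_eq_one fun i hi => if_pos (Finset.mem_filter.mp (hJ hi)).2
        · exact Finset.sum_nonneg hnonneg
    _ ≤ ∑ _J ∈ (Finset.univ : Finset ι).powersetCard t, ((a : ℝ) / Fintype.card β) ^ t := by
        rw [Finset.expect_sum_comm]
        refine Finset.sum_le_sum fun J hJ => ?_
        exact (Finset.mem_powersetCard.mp hJ).2 ▸ expect_prod_mem_le hS J
    _ = (Fintype.card ι).choose t * ((a : ℝ) / Fintype.card β) ^ t := by simp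

/-- The embedding that chooses the element `ω i` of the `i`-th of `m` disjoint blocks of `N`
variables. -/
def blockEmbedding {m N n : ℕ} (e : Fin m × Fin N ↪ Fin n) (ω : Fin m → Fin N) : Fin m ↪ Fin n where
  toFun i := e (i, ω i)
  inj' _ _ h := congrArg Prod.fst (e.injective h)

theorem isSpread_blockEmbedding {m N n : ℕ} (e : Fin m × Fin N ↪ Fin n) (a d : ℕ) :
    IsSpread (blockEmbedding e) a d
      (m.choose (d / 2 + 1) * ((a : ℝ) / N) ^ (d / 2 + 1)) := by
  intro A hA
  let S : Fin m → Finset (Fin N) := fun i => Finset.univ.filter fun b => e (i, b) ∈ A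
  have hS : ∀ i, (S i).card ≤ a := fun i => by
    refine le_trans (Finset.card_le_card_of_injOn (fun b => e (i, b)) (fun b hb => ?_) ?_) hA
    · simpa [S] using hb
    · exact fun b _ b' _ h => congrArg Prod.snd (e.injective h)
  have hmem : ∀ ω, A ∈ highSets (blockEmbedding e ω) d ↔
      d / 2 + 1 ≤ (Finset.univ.filter fun i => ω i ∈ S i).card := fun ω => by
    have hpreimage : A.preimage (blockEmbedding e ω) (blockEmbedding e ω).injective.injOn =
        Finset.univ.filter fun i => ω i ∈ S i := by
      ext i
      simp only [S, Finset.mem_preimage, Finset.mem_filter_univ]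
      rfl
    simp only [highSets, Finset.mem_filter_univ, hpreimage]
    omega
  simpa only [hmem, Fintype.card_fin] using expect_card_filter_mem_ge_le hS (d / 2 + 1)

end Blocks

section Amplification

open Matrix
open scoped BigOperators MatrixOrder

theorem add_mul_one_sub_pow_le {δ l : ℝ} (hδ : 0 ≤ δ) (hδ1 : δ ≤ 1) (hl : |l| ≤ 1) (k : ℕ) :
    (l + δ) * (1 - l) ^ (2 * k) ≤
      2 * (1 + δ) ^ (2 * k) + δ * (1 + 2 * δ) ^ (2 * k) * min (l + 2 * δ) 0 := by
  obtain ⟨hl1, hl2⟩ := abs_le.mp hl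
  have hpow : 0 ≤ (1 - l) ^ (2 * k) := pow_nonneg (by linarith) _
  have hhead : 0 ≤ 2 * (1 + δ) ^ (2 * k) := by positivity
  rcases le_or_gt (-(2 * δ)) l with h2δ | h2δ
  · rw [min_eq_right (by linarith), mul_zero, add_zero]
    rcases le_or_gt l (-δ) with h1δ | h1δ
    · exact (mul_nonpos_of_nonpos_of_nonneg (by linarith) hpow).trans hhead
    · exact mul_le_mul (by linarith) (pow_le_pow_left₀ (by linarith) (by linarith) _) hpow
        two_pos.le
  · rw [min_eq_left (by linarith)]
    have htail : δ * (1 + 2 * δ) ^ (2 * k) ≤ -(l + δ) * (1 - l) ^ (2 * k) :=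
      mul_le_mul (by linarith) (pow_le_pow_left₀ (by positivity) (by linarith) _) (by positivity)
        (by linarith)
    have hscale : δ * (1 + 2 * δ) ^ (2 * k) * -(l + 2 * δ) ≤ δ * (1 + 2 * δ) ^ (2 * k) * 1 :=
      mul_le_mul_of_nonneg_left (by linarith) (by positivity)
    linarith

variable {ι : Type*} [Fintype ι] [DecidableEq ι]

theorem abs_le_one_of_mem_spectrum {T : Matrix ι ι ℝ} (hT1 : -1 ≤ T) (hT2 : T ≤ 1) {l : ℝ}
    (hl : l ∈ spectrum ℝ T) : |l| ≤ 1 := by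
  have hT : IsSelfAdjoint T := .of_ge hT1 (IsSelfAdjoint.one _).neg
  exact abs_le.mpr
    ⟨(algebraMap_le_iff_le_spectrum (r := (-1 : ℝ)) (a := T)).mp (by simpa using hT1) l hl,
      (le_algebraMap_iff_spectrum_le (r := (1 : ℝ)) (a := T)).mp (by simpa using hT2) l hl⟩

theorem trace_add_mul_one_sub_pow_le {T Q : Matrix ι ι ℝ} {δ M : ℝ} (hδ : 0 ≤ δ) (hδ1 : δ ≤ 1)
    (hM : 0 < M) (hT1 : -1 ≤ T) (hT2 : T ≤ 1) (hQ : 0 ≤ Q) (hQM : Q ≤ M • 1) (k : ℕ) :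
    ((T + δ • 1) * (1 - T) ^ (2 * k)).trace ≤
      2 * (1 + δ) ^ (2 * k) * Fintype.card ι +
        δ * (1 + 2 * δ) ^ (2 * k) / M * ((T * Q).trace + 2 * δ * Q.trace) := by
  let N : Matrix ι ι ℝ := cfc (fun l => min (l + 2 * δ) 0) T
  have hT : IsSelfAdjoint T := .of_ge hT1 (IsSelfAdjoint.one _).neg
  have hcalculus : (T + δ • 1) * (1 - T) ^ (2 * k) ≤
      (2 * (1 + δ) ^ (2 * k)) • 1 + (δ * (1 + 2 * δ) ^ (2 * k)) • N := by
    calc (T + δ • 1) * (1 - T) ^ (2 * k)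
        = cfc (fun l => (l + δ) * (1 - l) ^ (2 * k)) T := by
          rw [cfc_mul (fun l : ℝ => l + δ) (fun l => (1 - l) ^ (2 * k)) T,
            cfc_pow (fun l : ℝ => 1 - l) (2 * k) T, cfc_sub .., cfc_add_const .., cfc_id' ..,
            cfc_const_one .., Algebra.algebraMap_eq_smul_one]
      _ ≤ cfc (fun l => 2 * (1 + δ) ^ (2 * k) +
            δ * (1 + 2 * δ) ^ (2 * k) * min (l + 2 * δ) 0) T :=
          cfc_mono fun l hl =>
            add_mul_one_sub_pow_le hδ hδ1 (abs_le_one_of_mem_spectrum hT1 hT2 hl) k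
      _ = _ := by
          rw [cfc_const_add .., cfc_const_mul .., Algebra.algebraMap_eq_smul_one]
  have hNT : N ≤ T + (2 * δ) • 1 := by
    calc N ≤ cfc (fun l => l + 2 * δ) T := cfc_mono fun _ _ => min_le_left _ _
      _ = T + (2 * δ) • 1 := by
        rw [cfc_add_const .., cfc_id' .., Algebra.algebraMap_eq_smul_one]
  have hN0 : N ≤ 0 := cfc_nonpos _ _ fun _ _ => min_le_right _ _
  have hNQ : M * N.trace ≤ (T * Q).trace + 2 * δ * Q.trace := by
    have hleft := trace_mul_le_trace_mul hQM (neg_nonneg.mpr hN0)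
    have hright := trace_mul_le_trace_mul hNT hQ
    rw [trace_mul_comm Q] at hleft
    simp only [Matrix.neg_mul, Matrix.mul_neg, Matrix.add_mul, Matrix.smul_mul, Matrix.one_mul,
      trace_neg, trace_add, trace_smul, smul_eq_mul] at hleft hright
    linarith
  have htrace := trace_le_trace hcalculus
  simp only [trace_add, trace_smul, trace_one, smul_eq_mul] at htrace
  refine htrace.trans (add_le_add_right ?_ _)
  rw [div_mul_eq_mul_div, mul_div_assoc]
  exact mul_le_mul_of_nonneg_left ((le_div_iff₀' hM).mpr hNQ) (by positivity)

end Amplification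

section LowDegree

open Matrix
open scoped BigOperators MatrixOrder

variable {m n : ℕ} {Ω ι : Type*} [Fintype Ω]

theorem pseudoOperator_apply_mem_sosSubspace (D : Cube m → ℝ) (τ : Ω → Fin m ↪ Fin n)
    (P : Ω → Matrix ι ι ℝ) (i j : ι) :
    (fun x => pseudoOperator D τ P x i j) ∈ sosSubspace n (2 * m) := by
  have hsum : (fun x => pseudoOperator D τ P x i j) =
      ∑ ω, (P ω i j / Fintype.card Ω) • fun x : Cube n => D (x ∘ τ ω) := by
    ext x
    have hentry := map_expect (entryLinearMap ℚ≥0 ℝ i j) (fun ω => D (x ∘ τ ω) • P ω) Finset.univ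
    simp only [entryLinearMap_apply, Matrix.smul_apply, Fintype.expect_eq_sum_div_card] at hentry
    simp only [pseudoOperator, hentry, Finset.sum_apply, Pi.smul_apply, smul_eq_mul,
      Finset.sum_div]
    exact Finset.sum_congr rfl fun _ _ => by ring
  exact hsum ▸ Submodule.sum_mem _ fun ω _ => Submodule.smul_mem _ _
    (comp_mem_sosSubspace (τ ω) (sosSubspace_eq_top le_rfl ▸ Submodule.mem_top))

theorem pseudoOperator_neg (D : Cube m → ℝ) (τ : Ω → Fin m ↪ Fin n) (P : Ω → Matrix ι ι ℝ)
    (x : Cube n) : pseudoOperator (-D) τ P x = -pseudoOperator D τ P x := by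
  simp [pseudoOperator, Finset.expect_neg_distrib]

theorem pseudoOperator_le [Finite ι] {D : Cube m → ℝ} (hD : ∀ y, D y ≤ 1)
    {P : Ω → Matrix ι ι ℝ} (hP : ∀ ω, 0 ≤ P ω) (τ : Ω → Fin m ↪ Fin n) (x : Cube n) :
    pseudoOperator D τ P x ≤ 𝔼 ω, P ω := by
  cases nonempty_fintype ι
  refine Finset.expect_le_expect fun ω _ => ?_
  simpa using smul_le_smul_of_nonneg_right (hD (x ∘ τ ω)) (hP ω)

theorem neg_one_le_pseudoOperator [Finite ι] [DecidableEq ι] {D : Cube m → ℝ}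
    (hD : ∀ y, |D y| ≤ 1) {P : Ω → Matrix ι ι ℝ} (hP : ∀ ω, 0 ≤ P ω) (hP1 : 𝔼 ω, P ω ≤ 1)
    (τ : Ω → Fin m ↪ Fin n) (x : Cube n) :
    -1 ≤ pseudoOperator D τ P x := by
  rw [neg_le, ← pseudoOperator_neg]
  exact (pseudoOperator_le (fun y => (neg_le_abs _).trans (hD y)) hP τ x).trans hP1

variable [Fintype ι]

theorem mul_apply_mem_sosSubspace {a b : ℕ} {A B : Cube n → Matrix ι ι ℝ}
    (hA : ∀ i j, (fun x => A x i j) ∈ sosSubspace n a)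
    (hB : ∀ i j, (fun x => B x i j) ∈ sosSubspace n b) (i j : ι) :
    (fun x => (A x * B x) i j) ∈ sosSubspace n (a + b) := by
  have hsum : (fun x => (A x * B x) i j) = ∑ l, (fun x => A x i l) * fun x => B x l j := by
    ext x
    simp [Matrix.mul_apply]
  exact hsum ▸ Submodule.sum_mem _ fun l _ => mul_mem_sosSubspace (hA i l) (hB l j)

variable [DecidableEq ι]

theorem pow_apply_mem_sosSubspace {a : ℕ} {A : Cube n → Matrix ι ι ℝ}
    (hA : ∀ i j, (fun x => A x i j) ∈ sosSubspace n a) (k : ℕ) (i j : ι) :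
    (fun x => (A x ^ k) i j) ∈ sosSubspace n (k * a) := by
  induction k generalizing i j with
  | zero => simpa using const_mem_sosSubspace _
  | succ k ih => simpa only [pow_succ, Nat.succ_mul] using mul_apply_mem_sosSubspace ih hA i j

theorem IsPseudoDensity.expect_trace_pseudoOperator_add_mul_pow_nonneg {d k : ℕ} {D : Cube m → ℝ}
    (hD : IsPseudoDensity (sosSubspace m d) D) {τ : Ω → Fin m ↪ Fin n} {p : ℝ}
    (hτ : IsSpread τ (k * m) d p) {P : Ω → Matrix ι ι ℝ} (hP : ∀ ω, 0 ≤ P ω) (hP1 : 𝔼 ω, P ω ≤ 1)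
    {K δ : ℝ} (hK : 0 ≤ K) (hPK : ∀ ω, P ω ≤ K • 1) (hδ : 0 < δ) (hδ1 : δ ≤ 1)
    (hKp : 6 * (K * p) ≤ δ ^ 2) :
    0 ≤ 𝔼 x, ((pseudoOperator D τ P x + δ • 1) * (1 - pseudoOperator D τ P x) ^ (2 * k)).trace := by
  let R : Cube n → Matrix ι ι ℝ := fun x => (1 - pseudoOperator D τ P x) ^ k
  have hRR : ∀ x, R x * (R x)ᴴ = (1 - pseudoOperator D τ P x) ^ (2 * k) := fun x => by
    have hself : IsSelfAdjoint (R x) := .pow (.sub (.one _)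
      (.of_ge (neg_one_le_pseudoOperator hD.abs_le_one hP hP1 τ x) (IsSelfAdjoint.one _).neg)) k
    rw [← star_eq_conjTranspose, hself.star_eq, ← pow_add, two_mul]
  have hR : ∀ i j, (fun x => R x i j) ∈ sosSubspace n (2 * (k * m)) := by
    have hsub : ∀ i j, (fun x => (1 - pseudoOperator D τ P x) i j) ∈ sosSubspace n (2 * m) :=
      fun i j => Submodule.sub_mem _ (const_mem_sosSubspace ((1 : Matrix ι ι ℝ) i j))
        (pseudoOperator_apply_mem_sosSubspace D τ P i j)
    rw [Nat.mul_left_comm]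
    exact pow_apply_mem_sosSubspace hsub k
  have hbound := hD.expect_trace_pseudoOperator_mul_ge hτ hP hP1 hK hPK (half_pos hδ) hR
  have hpos : 0 ≤ 𝔼 x, (R x * (R x)ᴴ).trace := Finset.expect_nonneg fun x _ =>
    (posSemidef_self_mul_conjTranspose (R x)).trace_nonneg
  have hcoef : δ / 2 + (1 + 1 / (δ / 2)) * K * p ≤ δ := by
    calc δ / 2 + (1 + 1 / (δ / 2)) * K * p
        = δ / 2 + (1 + 2 / δ) * (K * p) := by rw [one_div_div]; ring
      _ ≤ δ / 2 + (1 + 2 / δ) * (δ ^ 2 / 6) := by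
          gcongr
          linarith
      _ = δ / 2 + δ * (δ + 2) / 6 := by field_simp
      _ ≤ δ := by nlinarith
  have hscale := mul_le_mul_of_nonneg_right hcoef hpos
  simp only [hRR] at hbound hscale
  simp only [Matrix.add_mul, Matrix.smul_mul, Matrix.one_mul, trace_add, trace_smul, smul_eq_mul,
    Finset.expect_add_distrib, ← Finset.mul_expect]
  linarith

theorem IsPseudoDensity.expect_trace_pseudoOperator_mul_ge_of_le {d k : ℕ} {D : Cube m → ℝ}
    (hD : IsPseudoDensity (sosSubspace m d) D) {τ : Ω → Fin m ↪ Fin n} {p : ℝ}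
    (hτ : IsSpread τ (k * m) d p) {P : Ω → Matrix ι ι ℝ} (hP : ∀ ω, 0 ≤ P ω) (hP1 : 𝔼 ω, P ω ≤ 1)
    {K δ M : ℝ} (hK : 0 ≤ K) (hPK : ∀ ω, P ω ≤ K • 1) (hδ : 0 < δ) (hδ1 : δ ≤ 1)
    (hKp : 6 * (K * p) ≤ δ ^ 2) (hM : 0 < M) {Q : Cube n → Matrix ι ι ℝ} (hQ : ∀ x, 0 ≤ Q x)
    (hQM : ∀ x, Q x ≤ M • 1) :
    -(2 * δ * 𝔼 x, (Q x).trace + 2 * M / δ * (Fintype.card ι *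
      ((1 + δ) / (1 + 2 * δ)) ^ (2 * k))) ≤ 𝔼 x, (pseudoOperator D τ P x * Q x).trace := by
  have hpositive := hD.expect_trace_pseudoOperator_add_mul_pow_nonneg hτ hP hP1 hK hPK hδ hδ1 hKp
  have hspectral := Finset.expect_le_expect fun x (_ : x ∈ Finset.univ) =>
    trace_add_mul_one_sub_pow_le hδ.le hδ1 hM (neg_one_le_pseudoOperator hD.abs_le_one hP hP1 τ x)
      ((pseudoOperator_le (fun y => (le_abs_self _).trans (hD.abs_le_one y)) hP τ x).trans hP1)
      (hQ x) (hQM x) k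
  simp only [Finset.expect_add_distrib, ← Finset.mul_expect, Fintype.expect_const] at hspectral
  rw [div_pow]
  have hcoef : 0 < δ * (1 + 2 * δ) ^ (2 * k) / M := by positivity
  refine le_of_mul_le_mul_left ?_ hcoef
  calc _ = -(2 * (1 + δ) ^ (2 * k) * Fintype.card ι +
        δ * (1 + 2 * δ) ^ (2 * k) / M * (2 * δ * 𝔼 x, (Q x).trace)) := by
        field_simp
        ring
    _ ≤ _ := by linarith

end LowDegree

section Normalization

open Matrix
open scoped BigOperators MatrixOrder

variable {Ω X ι : Type*} [Fintype Ω] [Fintype ι] [DecidableEq ι]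

theorem exists_whitening {S : Matrix ι ι ℝ} (hS : 0 ≤ S) {η : ℝ} (hη : 0 < η) :
    ∃ G W : Matrix ι ι ℝ, W * G = 1 ∧ Gᴴ * G = S + η • 1 ∧ Wᴴ * S * W ≤ 1 ∧
      Wᴴ * W ≤ η⁻¹ • 1 := by
  have hpos : (S + η • 1).PosDef :=
    (PosDef.one.smul hη).posSemidef_add (nonneg_iff_posSemidef.mp hS)
  obtain ⟨G, hG⟩ := CStarAlgebra.nonneg_iff_eq_star_mul_self.mp
    (nonneg_iff_posSemidef.mpr hpos.posSemidef)
  rw [star_eq_conjTranspose] at hG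
  have hunit : IsUnit G := isUnit_of_mul_isUnit_right (hG ▸ hpos.isUnit)
  obtain ⟨W, hGW, hWG⟩ := isUnit_iff_exists.mp hunit
  have hsum : Wᴴ * S * W + η • (Wᴴ * W) = 1 := by
    calc Wᴴ * S * W + η • (Wᴴ * W) = Wᴴ * (S + η • 1) * W := by
          simp [Matrix.mul_add, Matrix.add_mul]
      _ = (G * W)ᴴ * (G * W) := by rw [hG, conjTranspose_mul]; simp only [Matrix.mul_assoc]
      _ = 1 := by simp [hGW]
  have hWSW : 0 ≤ Wᴴ * S * W := star_left_conjugate_nonneg hS W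
  have hWW : 0 ≤ Wᴴ * W := star_mul_self_nonneg W
  refine ⟨G, W, hWG, hG.symm, ?_, ?_⟩
  · exact hsum ▸ le_add_of_nonneg_right (smul_nonneg hη.le hWW)
  · rw [← inv_smul_smul₀ hη.ne' (Wᴴ * W)]
    exact smul_le_smul_of_nonneg_left (hsum ▸ le_add_of_nonneg_left hWSW) (inv_nonneg.mpr hη.le)

theorem exists_expect_le_one_of_trace_mul {P : Ω → Matrix ι ι ℝ} {Q : X → Matrix ι ι ℝ}
    (hP : ∀ ω, 0 ≤ P ω) (hQ : ∀ x, 0 ≤ Q x) {η : ℝ} (hη : 0 < η) :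
    ∃ (P' : Ω → Matrix ι ι ℝ) (Q' : X → Matrix ι ι ℝ), (∀ ω, 0 ≤ P' ω) ∧ (∀ x, 0 ≤ Q' x) ∧
      (∀ ω x, (P' ω * Q' x).trace = (P ω * Q x).trace) ∧ 𝔼 ω, P' ω ≤ 1 ∧
      (∀ ω c, 0 ≤ c → P ω ≤ c • 1 → P' ω ≤ (c / η) • 1) ∧
      ∀ x, (Q' x).trace = 𝔼 ω, (P ω * Q x).trace + η * (Q x).trace := by
  obtain ⟨G, W, hWG, hGG, hWSW, hWW⟩ := exists_whitening
    (Finset.expect_nonneg fun ω (_ : ω ∈ Finset.univ) => hP ω) hη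
  refine ⟨fun ω => Wᴴ * P ω * W, fun x => G * Q x * Gᴴ,
    fun ω => star_left_conjugate_nonneg (hP ω) W, fun x => star_right_conjugate_nonneg (hQ x) G,
    fun ω x => ?_, ?_, fun ω c hc hPc => ?_, fun x => ?_⟩
  · calc (Wᴴ * P ω * W * (G * Q x * Gᴴ)).trace
        = (P ω * (W * G) * Q x * (W * G)ᴴ).trace := by
          rw [Matrix.mul_assoc Wᴴ, Matrix.mul_assoc Wᴴ, trace_mul_comm, conjTranspose_mul]
          simp only [Matrix.mul_assoc]
      _ = (P ω * Q x).trace := by simp [hWG]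
  · simpa only [Finset.mul_expect, Finset.expect_mul] using hWSW
  · calc Wᴴ * P ω * W ≤ Wᴴ * (c • 1) * W := star_left_conjugate_le_conjugate hPc W
      _ = c • (Wᴴ * W) := by simp
      _ ≤ c • η⁻¹ • 1 := smul_le_smul_of_nonneg_left hWW hc
      _ = (c / η) • 1 := by rw [smul_smul, div_eq_mul_inv]
  · rw [trace_mul_cycle, hGG, Matrix.add_mul, trace_add, Finset.expect_mul, trace_expect,
      Matrix.smul_mul, Matrix.one_mul, trace_smul, smul_eq_mul]

theorem exists_normalization [Fintype X] [Nonempty X] [Nonempty Ω] [Nonempty ι]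
    {P : Ω → Matrix ι ι ℝ} {Q : X → Matrix ι ι ℝ} (hP : ∀ ω, 0 ≤ P ω) (hQ : ∀ x, 0 ≤ Q x) {C : ℝ}
    (hPQ : ∀ ω x, (P ω * Q x).trace ≤ C) :
    ∃ (P' : Ω → Matrix ι ι ℝ) (Q' : X → Matrix ι ι ℝ), (∀ ω, 0 ≤ P' ω) ∧ (∀ x, 0 ≤ Q' x) ∧
      (∀ ω x, (P' ω * Q' x).trace = (P ω * Q x).trace) ∧ 𝔼 ω, P' ω ≤ 1 ∧
      (∀ ω, P' ω ≤ (Fintype.card ι * (C + 1)) • 1) ∧ 𝔼 x, (Q' x).trace ≤ C + 1 := by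
  have hPtr : ∀ ω, 0 ≤ (P ω).trace := fun ω => (nonneg_iff_posSemidef.mp (hP ω)).trace_nonneg
  obtain ⟨η, hη, hηP⟩ : ∃ η : ℝ, 0 < η ∧ ∀ ω, η * (P ω).trace ≤ 1 := by
    have hsum : 0 ≤ ∑ ω, (P ω).trace := Finset.sum_nonneg fun ω _ => hPtr ω
    refine ⟨(1 + ∑ ω, (P ω).trace)⁻¹, by positivity, fun ω => ?_⟩
    rw [inv_mul_le_one₀ (by positivity)]
    linarith [Finset.single_le_sum (fun ω _ => hPtr ω) (Finset.mem_univ ω)]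
  obtain ⟨Q₁, P₁, hQ₁, hP₁, hQP₁, hmean₁, -, htrace₁⟩ :=
    exists_expect_le_one_of_trace_mul hQ hP hη
  have hP₁C : ∀ ω, (P₁ ω).trace ≤ C + 1 := fun ω => by
    rw [htrace₁]
    exact add_le_add (Finset.expect_le Finset.univ_nonempty fun x _ =>
      (trace_mul_comm (Q x) (P ω)).trans_le (hPQ ω x)) (hηP ω)
  have hC : 0 ≤ C + 1 :=
    (nonneg_iff_posSemidef.mp (hP₁ (Classical.arbitrary Ω))).trace_nonneg.trans (hP₁C _)
  have hcard : (0 : ℝ) < Fintype.card ι := by exact_mod_cast Fintype.card_pos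
  obtain ⟨P₂, Q₂, hP₂, hQ₂, hPQ₂, hmean₂, hbound₂, htrace₂⟩ :=
    exists_expect_le_one_of_trace_mul hP₁ hQ₁ (inv_pos.mpr hcard)
  have htrace : ∀ ω x, (P₁ ω * Q₁ x).trace = (P ω * Q x).trace := fun ω x => by
    rw [trace_mul_comm, hQP₁, trace_mul_comm]
  refine ⟨P₂, Q₂, hP₂, hQ₂, fun ω x => (hPQ₂ ω x).trans (htrace ω x), hmean₂, fun ω => ?_, ?_⟩
  · have hP₁1 : P₁ ω ≤ (C + 1) • 1 := (le_trace_smul_one (hP₁ ω)).trans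
      (smul_le_smul_of_nonneg_right (hP₁C ω) zero_le_one)
    simpa [div_inv_eq_mul, mul_comm] using hbound₂ ω _ hC hP₁1
  · calc 𝔼 x, (Q₂ x).trace
        = 𝔼 x, 𝔼 ω, (P ω * Q x).trace + (Fintype.card ι : ℝ)⁻¹ * (𝔼 x, Q₁ x).trace := by
          simp only [htrace₂, htrace, Finset.expect_add_distrib, ← Finset.mul_expect, trace_expect]
      _ ≤ C + (Fintype.card ι : ℝ)⁻¹ * (1 : Matrix ι ι ℝ).trace := by
          gcongr
          · exact Finset.expect_le Finset.univ_nonempty fun x _ =>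
              Finset.expect_le Finset.univ_nonempty fun ω _ => hPQ ω x
          · exact trace_le_trace hmean₁
      _ = C + 1 := by rw [trace_one, inv_mul_cancel₀ hcard.ne']

end Normalization

section Truncation

open Matrix
open scoped BigOperators MatrixOrder

variable {m n : ℕ} {Ω ι : Type*} [Fintype ι]

theorem exists_truncation [DecidableEq ι] {Q : Matrix ι ι ℝ} (hQ : 0 ≤ Q) {M : ℝ} (hM : 0 ≤ M) :
    ∃ Q' : Matrix ι ι ℝ, 0 ≤ Q' ∧ Q' ≤ M • 1 ∧ Q'.trace ≤ Q.trace ∧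
      (Q' = Q ∨ Q' = 0 ∧ M < Q.trace) := by
  by_cases hQM : Q.trace ≤ M
  · exact ⟨Q, hQ, (le_trace_smul_one hQ).trans (smul_le_smul_of_nonneg_right hQM zero_le_one),
      le_rfl, .inl rfl⟩
  · exact ⟨0, le_rfl, smul_nonneg hM zero_le_one, trace_le_trace hQ,
      .inr ⟨rfl, not_le.mp hQM⟩⟩

variable [Fintype Ω] [Nonempty Ω]

theorem neg_le_trace_pseudoOperator_mul {D : Cube m → ℝ} (hD : ∀ y, |D y| ≤ 1)
    (τ : Ω → Fin m ↪ Fin n) {P : Ω → Matrix ι ι ℝ} (hP : ∀ ω, 0 ≤ P ω) {R : Matrix ι ι ℝ}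
    (hR : 0 ≤ R) {C : ℝ} (hPR : ∀ ω, (P ω * R).trace ≤ C) (x : Cube n) :
    -C ≤ (pseudoOperator D τ P x * R).trace := by
  rw [trace_pseudoOperator_mul]
  refine Finset.le_expect Finset.univ_nonempty fun ω _ => ?_
  have hPR0 := trace_mul_nonneg (hP ω) hR
  have hDω := neg_le_of_abs_le (hD (x ∘ τ ω))
  nlinarith [hPR ω]

theorem IsPseudoDensity.expect_trace_pseudoOperator_mul_ge_of_trace_mul_le [DecidableEq ι]
    {d k : ℕ} {D : Cube m → ℝ} (hD : IsPseudoDensity (sosSubspace m d) D)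
    {τ : Ω → Fin m ↪ Fin n} {p : ℝ} (hτ : IsSpread τ (k * m) d p)
    {P : Ω → Matrix ι ι ℝ} (hP : ∀ ω, 0 ≤ P ω) (hP1 : 𝔼 ω, P ω ≤ 1)
    {Q : Cube n → Matrix ι ι ℝ} (hQ : ∀ x, 0 ≤ Q x) {C δ : ℝ} (hC : 0 ≤ C)
    (hPQ : ∀ ω x, (P ω * Q x).trace ≤ C)
    (hPK : ∀ ω, P ω ≤ (Fintype.card ι * (C + 1)) • 1) (hQC : 𝔼 x, (Q x).trace ≤ C + 1)
    (hδ : 0 < δ) (hδ1 : δ ≤ 1) (hp : 6 * (Fintype.card ι * (C + 1) * p) ≤ δ ^ 2)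
    (hk : 2 * (Fintype.card ι * ((1 + δ) / (1 + 2 * δ)) ^ (2 * k)) ≤ δ ^ 3) :
    -(4 * δ * (C + 1)) ≤ 𝔼 x, (pseudoOperator D τ P x * Q x).trace := by
  set M : ℝ := (C + 1) / δ with hM_def
  have hM : 0 < M := by positivity
  choose Q' hQ' hQ'M hQ'Q hQ'_eq using fun x => exists_truncation (hQ x) hM.le
  have hmain := hD.expect_trace_pseudoOperator_mul_ge_of_le hτ hP hP1 (by positivity) hPK hδ hδ1
    hp hM hQ' hQ'M
  have htrunc : ∀ x, (pseudoOperator D τ P x * Q' x).trace - C / M * (Q x).trace ≤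
      (pseudoOperator D τ P x * Q x).trace := fun x => by
    have hQtr : 0 ≤ (Q x).trace := (nonneg_iff_posSemidef.mp (hQ x)).trace_nonneg
    rcases hQ'_eq x with hx | ⟨hx, hMx⟩
    · rw [hx]
      exact sub_le_self _ (mul_nonneg (by positivity) hQtr)
    · have hCM : C ≤ C / M * (Q x).trace := by
        rw [div_mul_eq_mul_div, le_div_iff₀ hM]
        exact mul_le_mul_of_nonneg_left hMx.le hC
      have hge := neg_le_trace_pseudoOperator_mul hD.abs_le_one τ hP (hQ x) (hPQ · x) x
      rw [hx, Matrix.mul_zero, trace_zero]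
      linarith
  have hmean := Finset.expect_le_expect fun x (_ : x ∈ Finset.univ) => htrunc x
  rw [Finset.expect_sub_distrib, ← Finset.mul_expect] at hmean
  have hQ'C := (Finset.expect_le_expect fun x (_ : x ∈ Finset.univ) => hQ'Q x).trans hQC
  have hloss : C / M * 𝔼 x, (Q x).trace ≤ C * δ := by
    calc C / M * 𝔼 x, (Q x).trace ≤ C / M * (C + 1) := by gcongr
      _ = C * δ := by rw [hM_def]; field_simp
  have hlow : 2 * M / δ * (Fintype.card ι * ((1 + δ) / (1 + 2 * δ)) ^ (2 * k)) ≤ δ * (C + 1) := by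
    calc 2 * M / δ * (Fintype.card ι * ((1 + δ) / (1 + 2 * δ)) ^ (2 * k))
        = M / δ * (2 * (Fintype.card ι * ((1 + δ) / (1 + 2 * δ)) ^ (2 * k))) := by ring
      _ ≤ M / δ * δ ^ 3 := by gcongr
      _ = δ * (C + 1) := by rw [hM_def]; field_simp
  nlinarith [mul_le_mul_of_nonneg_left hQ'C hδ.le]

theorem IsPseudoDensity.expect_expect_comp_mul_trace_ge {d k : ℕ} {D : Cube m → ℝ}
    (hD : IsPseudoDensity (sosSubspace m d) D) {τ : Ω → Fin m ↪ Fin n} {p : ℝ}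
    (hτ : IsSpread τ (k * m) d p) {P : Ω → Matrix ι ι ℝ} (hP : ∀ ω, 0 ≤ P ω)
    {Q : Cube n → Matrix ι ι ℝ} (hQ : ∀ x, 0 ≤ Q x) {C δ : ℝ} (hC : 0 ≤ C)
    (hPQ : ∀ ω x, (P ω * Q x).trace ≤ C)
    (hδ : 0 < δ) (hδ1 : δ ≤ 1) (hp : 6 * (Fintype.card ι * (C + 1) * p) ≤ δ ^ 2)
    (hk : 2 * (Fintype.card ι * ((1 + δ) / (1 + 2 * δ)) ^ (2 * k)) ≤ δ ^ 3) :
    -(4 * δ * (C + 1)) ≤ 𝔼 ω, 𝔼 x, D (x ∘ τ ω) * (P ω * Q x).trace := by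
  classical
  rcases isEmpty_or_nonempty ι with hι | hι
  · simp only [trace, Finset.univ_eq_empty, Finset.sum_empty, mul_zero, Finset.expect_const_zero]
    have : 0 ≤ 4 * δ * (C + 1) := by positivity
    linarith
  obtain ⟨P', Q', hP', hQ', htrace, hP'1, hP'K, hQ'C⟩ := exists_normalization hP hQ hPQ
  have hge := hD.expect_trace_pseudoOperator_mul_ge_of_trace_mul_le hτ hP' hP'1 hQ' hC
    (fun ω x => (htrace ω x).trans_le (hPQ ω x)) hP'K hQ'C hδ hδ1 hp hk
  simpa only [trace_pseudoOperator_mul, htrace, Finset.expect_comm (s := Finset.univ (α := Ω))]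
    using hge

end Truncation

section SizeBounds

theorem half_le_log {n : ℕ} (hn : 2 ≤ n) : 1 / 2 ≤ Real.log n := by
  have hlog : Real.log 2 ≤ Real.log n := Real.log_le_log two_pos (by exact_mod_cast hn)
  linarith [Real.log_two_gt_d9]

theorem div_log_le_sq {n : ℕ} (hn : 2 ≤ n) : n / Real.log n ≤ (n : ℝ) ^ 2 := by
  have hn' : (2 : ℝ) ≤ n := by exact_mod_cast hn
  rw [div_le_iff₀ (by linarith [half_le_log hn])]
  nlinarith [half_le_log hn]

theorem rpow_div_four_le_pow_half_succ {n : ℕ} (hn : 2 ≤ n) (d : ℕ) :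
    ((n : ℝ) / Real.log n) ^ ((d : ℝ) / 4) ≤ ((n : ℝ) / Real.log n) ^ (d / 2 + 1) := by
  have hlog : 0 < Real.log n := by linarith [half_le_log hn]
  have hbase : 1 ≤ (n : ℝ) / Real.log n :=
    (one_le_div hlog).mpr (Real.log_le_self n.cast_nonneg)
  rw [← Real.rpow_natCast]
  refine Real.rpow_le_rpow_of_exponent_le hbase ?_
  have hd : (d : ℝ) ≤ 4 * (d / 2 + 1 : ℕ) := by exact_mod_cast (by omega)
  linarith

theorem exists_le_mul_log_pow_mul_pow_le {ρ η : ℝ} (hρ : 0 ≤ ρ) (hρ1 : ρ < 1) (hη : 0 < η)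
    (a : ℕ) : ∃ B : ℝ, 0 ≤ B ∧ ∀ n : ℕ, 2 ≤ n →
      ∃ k : ℕ, (k : ℝ) ≤ B * Real.log n ∧ (n : ℝ) ^ a * ρ ^ k ≤ η := by
  obtain ⟨q, hq⟩ := exists_pow_lt_of_lt_one (show 0 < min η 1 / 2 ^ a by positivity) hρ1
  refine ⟨4 * q, by positivity, fun n hn => ⟨q * (Nat.log 2 n + 1), ?_, ?_⟩⟩
  · have hlog : (Nat.log 2 n : ℝ) * Real.log 2 ≤ Real.log n := by
      rw [← Real.log_pow]
      exact Real.log_le_log (by positivity) (by exact_mod_cast Nat.pow_log_le_self 2 (by omega))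
    have hbits : (Nat.log 2 n : ℝ) + 1 ≤ 4 * Real.log n := by
      nlinarith [half_le_log hn, Real.log_two_gt_d9, (Nat.log 2 n).cast_nonneg (α := ℝ)]
    push_cast
    nlinarith [q.cast_nonneg (α := ℝ)]
  · have hn' : (n : ℝ) ≤ 2 ^ (Nat.log 2 n + 1) := by
      exact_mod_cast (Nat.lt_pow_succ_log_self one_lt_two n).le
    calc (n : ℝ) ^ a * ρ ^ (q * (Nat.log 2 n + 1))
        ≤ (2 ^ (Nat.log 2 n + 1)) ^ a * (min η 1 / 2 ^ a) ^ (Nat.log 2 n + 1) := by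
          rw [pow_mul]
          gcongr
      _ = min η 1 ^ (Nat.log 2 n + 1) := by
          rw [← pow_mul, mul_comm (_ + 1) a, pow_mul, ← mul_pow, mul_div_cancel₀ _ (by positivity)]
      _ ≤ min η 1 := pow_le_of_le_one (by positivity) (min_le_right _ _) (Nat.succ_ne_zero _)
      _ ≤ η := min_le_left _ _

theorem exists_size_bound {ρ η γ : ℝ} (hρ : 0 ≤ ρ) (hρ1 : ρ < 1) (hη : 0 < η) (hγ : 0 < γ)
    {L : ℝ} (hL : 0 ≤ L) (t : ℕ) :
    ∃ α : ℝ, 0 < α ∧ ∀ n r : ℕ, 2 ≤ n → (r : ℝ) ≤ α * ((n : ℝ) / Real.log n) ^ t →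
      ∃ k : ℕ, r * ρ ^ k ≤ η ∧ r * (L * k / n) ^ t ≤ γ := by
  obtain ⟨B, hB, hk⟩ := exists_le_mul_log_pow_mul_pow_le hρ hρ1 hη (2 * t)
  refine ⟨min 1 (γ / ((L * B) ^ t + 1)), by positivity, fun n r hn hr => ?_⟩
  obtain ⟨k, hkB, hkη⟩ := hk n hn
  have hlog : 0 < Real.log n := by linarith [half_le_log hn]
  refine ⟨k, le_trans ?_ hkη, ?_⟩
  · refine mul_le_mul_of_nonneg_right ?_ (by positivity)
    calc (r : ℝ) ≤ 1 * ((n : ℝ) / Real.log n) ^ t := hr.trans (by gcongr; exact min_le_left _ _)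
      _ ≤ (n : ℝ) ^ (2 * t) := by
          rw [one_mul, pow_mul]
          gcongr
          exact div_log_le_sq hn
  · calc r * (L * k / n) ^ t
        ≤ γ / ((L * B) ^ t + 1) * ((n : ℝ) / Real.log n) ^ t *
            (L * (B * Real.log n) / n) ^ t := by
          gcongr
          exact hr.trans (by gcongr; exact min_le_right _ _)
      _ = γ * ((L * B) ^ t / ((L * B) ^ t + 1)) := by
          rw [mul_assoc, ← mul_pow, div_mul_eq_mul_div, ← mul_div_assoc]
          field_simp
      _ ≤ γ := mul_le_of_le_one_right hγ.le (div_le_one_of_le₀ (by linarith) (by positivity))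

end SizeBounds

section PatternMatrix

open Matrix
open scoped BigOperators MatrixOrder Topology

variable {m n : ℕ}

theorem nonneg_of_mem_closure_psdConstCone {ι κ : Type*} [Fintype ι] {Q : κ → Matrix ι ι ℝ}
    (hQ : ∀ x, (Q x).PosSemidef) {f : κ → ℝ}
    (hf : f ∈ closure (psdConstCone Q : Set (κ → ℝ))) : 0 ≤ f := by
  classical
  refine closure_minimal (fun g hg x => ?_) isClosed_Ici hf
  obtain ⟨P, hP, b, hb, hg⟩ := mem_psdConstCone.mp hg
  rw [hg]
  exact add_nonneg (trace_mul_nonneg hP.nonneg (hQ x).nonneg) hb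

theorem exists_approx_of_mem_closure_psdConstCone {ι κ : Type*} [Fintype ι] [Finite κ]
    {Q : κ → Matrix ι ι ℝ} {f : κ → ℝ} (hf : f ∈ closure (psdConstCone Q : Set (κ → ℝ))) {ε : ℝ}
    (hε : 0 < ε) :
    ∃ P : Matrix ι ι ℝ, 0 ≤ P ∧ ∃ b : ℝ, 0 ≤ b ∧ ∀ x, |f x - ((P * Q x).trace + b)| < ε := by
  cases nonempty_fintype κ
  obtain ⟨g, hg, hfg⟩ := Metric.mem_closure_iff.mp hf ε hε
  obtain ⟨P, hP, b, hb, hg⟩ := mem_psdConstCone.mp hg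
  refine ⟨P, hP.nonneg, b, hb, fun x => ?_⟩
  rw [← hg, ← Real.dist_eq]
  exact (dist_pi_lt_iff hε).mp hfg x

theorem IsPseudoDensity.exists_comp_notMem_closure {Ω ι : Type*} [Fintype Ω] [Nonempty Ω]
    [Fintype ι] {d k : ℕ} {D : Cube m → ℝ} (hD : IsPseudoDensity (sosSubspace m d) D)
    {τ : Ω → Fin m ↪ Fin n} {p : ℝ} (hτ : IsSpread τ (k * m) d p) {Q : Cube n → Matrix ι ι ℝ}
    (hQ : ∀ x, 0 ≤ Q x) {C δ : ℝ} (hC : 0 ≤ C) (hδ : 0 < δ) (hδ1 : δ ≤ 1)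
    (hp : 6 * (Fintype.card ι * (C + 1) * p) ≤ δ ^ 2)
    (hk : 2 * (Fintype.card ι * ((1 + δ) / (1 + 2 * δ)) ^ (2 * k)) ≤ δ ^ 3)
    {f : Cube m → ℝ} (hfC : ∀ y, f y + 1 ≤ C) (hDf : 𝔼 y, D y * f y < -(4 * δ * (C + 1))) :
    ∃ ω, (fun x => f (x ∘ τ ω)) ∉ closure (psdConstCone Q : Set (Cube n → ℝ)) := by
  classical
  by_contra! hclosure
  obtain ⟨ε, hε, hεgap⟩ := exists_between
    (lt_min one_pos (sub_pos.mpr hDf) : 0 < min 1 (-(4 * δ * (C + 1)) - 𝔼 y, D y * f y))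
  obtain ⟨hε1, hεgap⟩ := lt_min_iff.mp hεgap
  choose P hP b hb happrox using fun ω => exists_approx_of_mem_closure_psdConstCone (hclosure ω) hε
  have hPQ : ∀ ω x, (P ω * Q x).trace ≤ C := fun ω x => by
    linarith [(abs_lt.mp (happrox ω x)).1, hfC (x ∘ τ ω), hb ω]
  have hupper : ∀ ω, 𝔼 x, D (x ∘ τ ω) * (P ω * Q x).trace ≤ 𝔼 y, D y * f y + ε := fun ω => by
    have hconst : 0 ≤ 𝔼 x : Cube n, D (x ∘ τ ω) * b ω := by
      rw [expect_comp_embedding (τ ω) fun y => D y * b ω, ← Finset.expect_mul]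
      have hmean := hD.expect_mul_sq_nonneg _ (const_mem_sosSubspace 1)
      simp only [one_pow, mul_one] at hmean
      exact mul_nonneg hmean (hb ω)
    calc 𝔼 x, D (x ∘ τ ω) * (P ω * Q x).trace
        ≤ 𝔼 x, (D (x ∘ τ ω) * f (x ∘ τ ω) + ε - D (x ∘ τ ω) * b ω) := by
          refine Finset.expect_le_expect fun x _ => ?_
          have hDx := abs_le.mp (hD.abs_le_one (x ∘ τ ω))
          have hx := abs_lt.mp (happrox ω x)
          nlinarith
      _ ≤ 𝔼 y, D y * f y + ε := by
          rw [Finset.expect_sub_distrib, Finset.expect_add_distrib, Fintype.expect_const,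
            expect_comp_embedding (τ ω) fun y => D y * f y]
          linarith
  have hlower := hD.expect_expect_comp_mul_trace_ge hτ hP hQ hC hPQ hδ hδ1 hp hk
  linarith [hlower.trans (Finset.expect_le Finset.univ_nonempty fun ω _ => hupper ω)]

/-- The pattern matrix `(σ, x) ↦ f (x ∘ σ)` is not a limit of matrices `(σ, x) ↦ Tr(P_σ Q_x) + b_σ`
with `P_σ` and `Q_x` positive semidefinite of size `r` and `b_σ ≥ 0`, for any fixed choice of the
`Q_x`. -/
def IsPsdHard (f : Cube m → ℝ) (n r : ℕ) : Prop :=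
  ∀ Q : Cube n → Matrix (Fin r) (Fin r) ℝ, (∀ x, (Q x).PosSemidef) →
    ∃ σ : Fin m ↪ Fin n, (fun x => f (x ∘ σ)) ∉ closure (psdConstCone Q : Set (Cube n → ℝ))

theorem exists_blockEmbedding_isSpread_le (hm : 0 < m) (hmn : m ≤ n) (k d : ℕ) :
    ∃ e : Fin m × Fin (n / m) ↪ Fin n, IsSpread (blockEmbedding e) (k * m) d
      (m.choose (d / 2 + 1) * (2 * m ^ 2 * k / n) ^ (d / 2 + 1)) := by
  obtain ⟨e⟩ : Nonempty (Fin m × Fin (n / m) ↪ Fin n) :=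
    Function.Embedding.nonempty_of_card_le (by simpa using Nat.mul_div_le n m)
  refine ⟨e, fun A hA => (isSpread_blockEmbedding e (k * m) d A hA).trans ?_⟩
  have hN : (0 : ℝ) < (n / m : ℕ) := by exact_mod_cast Nat.div_pos hmn hm
  have hn : (0 : ℝ) < n := by exact_mod_cast hm.trans_le hmn
  have hnN : (n : ℝ) ≤ 2 * m * (n / m : ℕ) := by
    have := Nat.div_add_mod n m
    have := Nat.mod_lt n hm
    have := Nat.le_mul_of_pos_right m (Nat.div_pos hmn hm)
    exact_mod_cast (by nlinarith : n ≤ 2 * m * (n / m))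
  have hratio : ((k * m : ℕ) : ℝ) / (n / m : ℕ) ≤ 2 * m ^ 2 * k / n := by
    rw [div_le_div_iff₀ hN hn]
    push_cast
    calc (k : ℝ) * m * n ≤ k * m * (2 * m * (n / m : ℕ)) := by gcongr
      _ = 2 * m ^ 2 * k * (n / m : ℕ) := by ring
  gcongr

theorem IsPseudoDensity.isPsdHard {d k r : ℕ} {D : Cube m → ℝ}
    (hD : IsPseudoDensity (sosSubspace m d) D) (hm : 0 < m) (hmn : m ≤ n) {C δ : ℝ} (hC : 0 ≤ C)
    (hδ : 0 < δ) (hδ1 : δ ≤ 1)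
    (hp : 6 * (r * (C + 1) * (m.choose (d / 2 + 1) * (2 * m ^ 2 * k / n) ^ (d / 2 + 1))) ≤ δ ^ 2)
    (hk : 2 * (r * ((1 + δ) / (1 + 2 * δ)) ^ (2 * k)) ≤ δ ^ 3) {f : Cube m → ℝ}
    (hfC : ∀ y, f y + 1 ≤ C) (hDf : 𝔼 y, D y * f y < -(4 * δ * (C + 1))) : IsPsdHard f n r := by
  intro Q hQ
  obtain ⟨e, he⟩ := exists_blockEmbedding_isSpread_le hm hmn k d
  have : Nonempty (Fin (n / m)) := Fin.pos_iff_nonempty.mp (Nat.div_pos hmn hm)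
  obtain ⟨ω, hω⟩ := hD.exists_comp_notMem_closure he (fun x => (hQ x).nonneg) hC hδ hδ1
    (by rwa [Fintype.card_fin]) (by rwa [Fintype.card_fin]) hfC hDf
  exact ⟨_, hω⟩

theorem exists_isPsdHard_of_not_isSumSqOf {d : ℕ} {f : Cube m → ℝ} (hm : 0 < m)
    (hf : ¬ IsSumSqOf (sosSubspace m d) f) :
    ∃ α : ℝ, 0 < α ∧ ∀ n r : ℕ, 2 ≤ n → m ≤ n →
      (r : ℝ) ≤ α * ((n : ℝ) / Real.log n) ^ (d / 2 + 1) → IsPsdHard f n r := by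
  obtain ⟨D, hD, hDf⟩ := exists_isPseudoDensity_of_not_isSumSqOf hf
  set C : ℝ := ‖f‖ + 1
  have hfC : ∀ y, f y + 1 ≤ C := fun y =>
    add_le_add_left ((le_abs_self _).trans (norm_le_pi_norm f y)) 1
  obtain ⟨δ, hδ, hδ_lt⟩ := exists_between (lt_min one_pos
    (div_pos (neg_pos.mpr hDf) (by positivity : 0 < 4 * (C + 1))))
  obtain ⟨hδ1, hδgap⟩ := lt_min_iff.mp hδ_lt
  rw [lt_div_iff₀ (by positivity)] at hδgap
  set β : ℝ := m.choose (d / 2 + 1) + 1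
  obtain ⟨α, hα, hsize⟩ := exists_size_bound
    (ρ := ((1 + δ) / (1 + 2 * δ)) ^ 2) (η := δ ^ 3 / 2) (γ := δ ^ 2 / (6 * (C + 1) * β))
    (L := 2 * m ^ 2) (by positivity)
    (pow_lt_one₀ (by positivity) ((div_lt_one (by positivity)).mpr (by linarith)) two_ne_zero)
    (by positivity) (by positivity) (by positivity) (d / 2 + 1)
  refine ⟨α, hα, fun n r hn hmn hr => ?_⟩
  obtain ⟨k, hk, hp⟩ := hsize n r hn hr
  refine hD.isPsdHard hm hmn (k := k) (by positivity) hδ hδ1.le ?_ ?_ hfC (by linarith)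
  · rw [le_div_iff₀ (by positivity)] at hp
    calc _ = r * (2 * m ^ 2 * k / n) ^ (d / 2 + 1) *
          (6 * (C + 1) * m.choose (d / 2 + 1)) := by ring
      _ ≤ r * (2 * m ^ 2 * k / n) ^ (d / 2 + 1) * (6 * (C + 1) * β) := by
          gcongr
          exact (lt_add_one _).le
      _ ≤ δ ^ 2 := hp
  · rw [pow_mul]
    linarith

theorem isSumSqOf_top_of_nonneg {f : Cube n → ℝ} (hf : 0 ≤ f) : IsSumSqOf ⊤ f := by
  rw [← funext fun x => Real.sq_sqrt (hf x)]
  exact isSumSqOf_sq (f := fun x => √(f x)) Submodule.mem_top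

theorem isPsdHard_of_not_isSumSqOf [Nonempty (Fin m ↪ Fin n)] {d : ℕ} (hd : 2 * m ≤ d)
    {f : Cube m → ℝ} (hf : ¬ IsSumSqOf (sosSubspace m d) f) (r : ℕ) : IsPsdHard f n r := by
  intro Q hQ
  obtain ⟨σ⟩ := ‹Nonempty (Fin m ↪ Fin n)›
  rw [sosSubspace_eq_top hd] at hf
  refine ⟨σ, fun hmem => hf (isSumSqOf_top_of_nonneg fun y => ?_)⟩
  obtain ⟨x, rfl⟩ := σ.injective.surjective_comp_right y
  exact nonneg_of_mem_closure_psdConstCone hQ hmem x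

theorem exists_forall_isPsdHard (f : ℕ → Cube m → ℝ) :
    ∃ α : ℝ, 0 < α ∧ ∀ d, ¬ IsSumSqOf (sosSubspace m d) (f d) → ∀ n r : ℕ, 2 ≤ n → m ≤ n →
      (r : ℝ) ≤ α * ((n : ℝ) / Real.log n) ^ (d / 2 + 1) → IsPsdHard (f d) n r := by
  have hlow : ∀ d, ∃ α : ℝ, 0 < α ∧ (d < 2 * m → ¬ IsSumSqOf (sosSubspace m d) (f d) →
      ∀ n r : ℕ, 2 ≤ n → m ≤ n → (r : ℝ) ≤ α * ((n : ℝ) / Real.log n) ^ (d / 2 + 1) →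
      IsPsdHard (f d) n r) := fun d => by
    by_cases hd : d < 2 * m ∧ ¬ IsSumSqOf (sosSubspace m d) (f d)
    · obtain ⟨α, hα, hhard⟩ := exists_isPsdHard_of_not_isSumSqOf (by omega) hd.2
      exact ⟨α, hα, fun _ _ => hhard⟩
    · exact ⟨1, one_pos, fun hdm hf => (hd ⟨hdm, hf⟩).elim⟩
  choose α hα hhard using hlow
  have hmin : ∀ᶠ β in 𝓝[>] (0 : ℝ), ∀ d ∈ Finset.range (2 * m), β ≤ α d :=
    (Finset.eventually_all _).mpr fun d _ =>
      Filter.mem_of_superset (Ioc_mem_nhdsGT (hα d)) fun β hβ => hβ.2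
  obtain ⟨β, hβα, hβ⟩ := (hmin.and self_mem_nhdsWithin).exists
  refine ⟨β, hβ, fun d hf n r hn hmn hr => ?_⟩
  by_cases hd : d < 2 * m
  · refine hhard d hd hf n r hn hmn (hr.trans ?_)
    have hlog : 0 < Real.log n := by linarith [half_le_log hn]
    gcongr
    exact hβα d (Finset.mem_range.mpr hd)
  · have : Nonempty (Fin m ↪ Fin n) := ⟨Fin.castLEEmb hmn⟩
    exact isPsdHard_of_not_isSumSqOf (not_lt.mp hd) hf r

end PatternMatrix

section Relaxations

open Matrix
open scoped BigOperators

variable {k : ℕ} {Preds : Finset ((Fin k → Bool) → Bool)} {m n : ℕ}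

/-- The copy of an instance on the variables in the range of `σ`. -/
def CSPInstance.embed (I : CSPInstance Preds m) (σ : Fin m ↪ Fin n) : CSPInstance Preds n where
  size := I.size
  size_pos := I.size_pos
  constraint j :=
    { pred := (I.constraint j).pred
      pred_mem := (I.constraint j).pred_mem
      index := (I.constraint j).index.trans σ }

theorem CSPInstance.opt_embed_le (I : CSPInstance Preds m) (σ : Fin m ↪ Fin n) :
    (I.embed σ).opt ≤ I.opt :=
  Finset.sup'_le _ _ fun x _ => Finset.le_sup' I.value (Finset.mem_univ (x ∘ σ))

/-- On every instance with `opt ≤ s`, the bound `I(x) ≤ c` has, up to arbitrarily small errors, a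
certificate of the form `c - I(x) = Tr(P Q(x)) + b` with `P` positive semidefinite and `b ≥ 0`. -/
def PsdCertifies {ι : Type*} [Fintype ι] (Preds : Finset ((Fin k → Bool) → Bool)) (c s : ℝ)
    (Q : Cube n → Matrix ι ι ℝ) : Prop :=
  ∀ I : CSPInstance Preds n, I.opt ≤ s →
    (fun x => c - I.value x) ∈ closure (psdConstCone Q : Set (Cube n → ℝ))

theorem IsPsdHard.not_psdCertifies {I : CSPInstance Preds m} {c s : ℝ} {r : ℕ} (hI : I.opt ≤ s)
    (hhard : IsPsdHard (fun y => c - I.value y) n r) {Q : Cube n → Matrix (Fin r) (Fin r) ℝ}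
    (hQ : ∀ x, (Q x).PosSemidef) : ¬ PsdCertifies Preds c s Q := by
  intro hcert
  obtain ⟨σ, hσ⟩ := hhard Q hQ
  exact hσ (hcert (I.embed σ) ((I.opt_embed_le σ).trans hI))

section Subspace

variable {U : Submodule ℝ (Cube n → ℝ)} {f : Cube n → ℝ} {c s : ℝ}

theorem exists_not_isSumSqOf_of_not_subspaceAchieves (hU : ¬ SubspaceAchieves Preds U c s) :
    ∃ I : CSPInstance Preds n, I.opt ≤ s ∧ ¬ IsSumSqOf U fun x => c - I.value x := by
  unfold SubspaceAchieves at hU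
  push Not at hU
  obtain ⟨I, hI, hlt⟩ := hU
  exact ⟨I, hI, fun hsum => hlt.not_ge (sInf_le ⟨c, rfl, hsum⟩)⟩

theorem sub_mem_closure_of_sosUpperBound_le (hf : sosUpperBound U f ≤ c) :
    (fun x => c - f x) ∈ closure (psdConstCone (basisGram U) : Set (Cube n → ℝ)) := by
  have hmem : ∀ a > c, (fun x => a - f x) ∈ psdConstCone (basisGram U) := fun a hca => by
    obtain ⟨_, ⟨b, rfl, hb⟩, hba⟩ := sInf_lt_iff.mp (hf.trans_lt (EReal.coe_lt_coe_iff.mpr hca))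
    obtain ⟨P, hP, hbP⟩ := hb.mem_psdCone
    refine mem_psdConstCone.mpr
      ⟨P, hP, a - b, sub_nonneg.mpr (EReal.coe_lt_coe_iff.mp hba).le, fun x => ?_⟩
    rw [← congrFun hbP x]
    ring
  have hlim : Filter.Tendsto (fun a x => a - f x) (nhdsWithin c (Set.Ioi c))
      (nhds fun x => c - f x) :=
    (Continuous.tendsto (by fun_prop) c).mono_left nhdsWithin_le_nhds
  exact mem_closure_of_tendsto hlim (Filter.eventually_of_mem self_mem_nhdsWithin hmem)

theorem SubspaceAchieves.psdCertifies (hU : SubspaceAchieves Preds U c s) :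
    PsdCertifies Preds c s (basisGram U) :=
  fun I hI => sub_mem_closure_of_sosUpperBound_le (hU I hI)

end Subspace

section SDP

variable {r : ℕ} {R : SDPRelaxation Preds n r} {c s : ℝ}

theorem SDPRelaxation.Achieves.sum_mul_value_le (hR : R.Achieves c s) {I : CSPInstance Preds n}
    (hI : I.opt ≤ s) {w : Cube n → ℝ} (hw : ∑ x, w x = 1)
    (hpsd : (∑ x, w x • R.linPoint x).PosSemidef) : ∑ x, w x * I.value x ≤ c := by
  have haffine : ∑ x, w x • R.linPoint x ∈ R.affine := by
    rw [← Finset.affineCombination_eq_linear_combination _ _ _ hw]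
    exact affineSpan_le.mpr (Set.range_subset_iff.mpr R.point_affine)
      (affineCombination_mem_affineSpan hw R.linPoint)
  have hvalue := (le_iSup₂ (f := fun Y (_ : Y ∈ R.feasible) =>
    (matrixInner (R.linInstance I) Y : EReal)) _ ⟨haffine, hpsd⟩).trans (hR I hI)
  rw [EReal.coe_le_coe_iff, matrixInner, Finset.mul_sum, trace_sum] at hvalue
  simpa only [Matrix.mul_smul, trace_smul, smul_eq_mul, ← R.inner_eq I, matrixInner] using hvalue

theorem SDPRelaxation.Achieves.dotProduct_nonneg_of_sum_pos (hR : R.Achieves c s)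
    {I : CSPInstance Preds n} (hI : I.opt ≤ s) {μ : Cube n → ℝ} (hμ : 0 < ∑ x, μ x)
    (hpsd : (∑ x, μ x • R.linPoint x).PosSemidef) : 0 ≤ μ ⬝ᵥ fun x => c - I.value x := by
  have hvalue := hR.sum_mul_value_le hI (w := fun x => (∑ x, μ x)⁻¹ * μ x)
    (by rw [← Finset.mul_sum, inv_mul_cancel₀ hμ.ne'])
    (by simpa only [mul_smul, ← Finset.smul_sum] using hpsd.smul (inv_nonneg.mpr hμ.le))
  simp only [mul_assoc, ← Finset.mul_sum] at hvalue
  rw [inv_mul_le_iff₀ hμ] at hvalue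
  simpa only [dotProduct, mul_sub, Finset.sum_sub_distrib, ← Finset.sum_mul, sub_nonneg]
    using hvalue

theorem posSemidef_sum_smul_of_trace_mul_nonneg {ι κ : Type*} [Fintype ι] [Fintype κ]
    {Q : κ → Matrix ι ι ℝ} (hQ : ∀ x, (Q x).PosSemidef) {μ : κ → ℝ}
    (hμ : ∀ q ∈ psdCone Q, 0 ≤ μ ⬝ᵥ q) : (∑ x, μ x • Q x).PosSemidef := by
  refine .of_dotProduct_mulVec_nonneg ?_ fun v => ?_
  · simp only [IsHermitian, conjTranspose_sum, conjTranspose_smul, (hQ _).1.eq, star_trivial]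
  · refine (hμ _ ⟨vecMulVec v v, posSemidef_vecMulVec_self_star v, rfl⟩).trans_eq ?_
    rw [star_trivial, sum_mulVec, dotProduct_sum, dotProduct]
    refine Finset.sum_congr rfl fun x _ => ?_
    rw [smul_mulVec, dotProduct_smul, smul_eq_mul, trace_mul_comm, mul_vecMulVec, trace_vecMulVec,
      dotProduct_comm]

-- A separating functional may have mean zero; adding a small point mass makes it normalisable.
theorem SDPRelaxation.Achieves.dotProduct_nonneg (hR : R.Achieves c s) {I : CSPInstance Preds n}
    (hI : I.opt ≤ s) {μ : Cube n → ℝ} (hμ : ∀ q ∈ psdConstCone R.linPoint, 0 ≤ μ ⬝ᵥ q) :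
    0 ≤ μ ⬝ᵥ fun x => c - I.value x := by
  have hsum : 0 ≤ ∑ x, μ x := by
    simpa [dotProduct] using hμ 1
      (Submodule.mem_sup_right (PointedCone.subset_hull (Set.mem_singleton 1)))
  have hpsd : (∑ x, μ x • R.linPoint x).PosSemidef :=
    posSemidef_sum_smul_of_trace_mul_nonneg R.point_psd fun q hq =>
      hμ q (Submodule.mem_sup_left hq)
  let x₀ : Cube n := fun _ => false
  have hperturb : ∀ t > (0 : ℝ),
      0 ≤ μ ⬝ᵥ (fun x => c - I.value x) + t * (c - I.value x₀) := fun t ht => by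
    let ν : Cube n → ℝ := μ + Pi.single x₀ t
    have hpos : 0 < ∑ x, ν x := by
      simpa [ν, Finset.sum_add_distrib] using add_pos_of_nonneg_of_pos hsum ht
    have hpsd_ν : (∑ x, ν x • R.linPoint x).PosSemidef := by
      simpa [ν, add_smul, Finset.sum_add_distrib, Pi.single_apply, ite_smul] using
        hpsd.add ((R.point_psd x₀).smul ht.le)
    simpa [ν, add_dotProduct] using hR.dotProduct_nonneg_of_sum_pos hI hpos hpsd_ν
  have hlim : Filter.Tendsto
      (fun t : ℝ => μ ⬝ᵥ (fun x => c - I.value x) + t * (c - I.value x₀))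
      (nhdsWithin 0 (Set.Ioi 0)) (nhds (μ ⬝ᵥ fun x => c - I.value x)) :=
    (Continuous.tendsto' (by fun_prop) 0 _ (by simp)).mono_left nhdsWithin_le_nhds
  exact ge_of_tendsto hlim (Filter.eventually_of_mem self_mem_nhdsWithin hperturb)

theorem SDPRelaxation.Achieves.psdCertifies (hR : R.Achieves c s) :
    PsdCertifies Preds c s R.linPoint := by
  intro I hI
  by_contra hmem
  obtain ⟨μ, hμ, hneg⟩ := exists_dotProduct_separating hmem
  exact hneg.not_ge (hR.dotProduct_nonneg hI hμ)

end SDP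

end Relaxations

theorem mainTheorem4_general {k : ℕ} (Preds : Finset ((Fin k → Bool) → Bool)) (m : ℕ) (c s : ℝ) :
    ∃ α : ℝ, 0 < α ∧
      ∀ d : ℕ, ¬ SubspaceAchieves Preds (sosSubspace m d) c s →
        ∀ n : ℕ, m ≤ n → 2 ≤ n →
          (∀ U : Submodule ℝ (Cube n → ℝ),
            (Module.finrank ℝ U : ℝ) ≤ α * ((n : ℝ) / Real.log (n : ℝ)) ^ (d / 2 + 1) →
              ¬ SubspaceAchieves Preds U c s) ∧
          (∀ (r : ℕ) (R : SDPRelaxation Preds n r),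
            (r : ℝ) ≤ α * ((n : ℝ) / Real.log (n : ℝ)) ^ (d / 2 + 1) →
              ¬ R.Achieves c s) := by
  have hfail : ∀ d, ¬ SubspaceAchieves Preds (sosSubspace m d) c s →
      ∃ f : Cube m → ℝ, ¬ IsSumSqOf (sosSubspace m d) f ∧
        ∃ I : CSPInstance Preds m, I.opt ≤ s ∧ f = fun y => c - I.value y := fun d hd => by
    obtain ⟨I, hI, hns⟩ := exists_not_isSumSqOf_of_not_subspaceAchieves hd
    exact ⟨_, hns, I, hI, rfl⟩
  choose! f hf hfI using hfail
  obtain ⟨α, hα, hhard⟩ := exists_forall_isPsdHard f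
  refine ⟨α, hα, fun d hd n hmn hn => ?_⟩
  obtain ⟨I, hI, hfd⟩ := hfI d hd
  have hI_hard : ∀ r : ℕ, (r : ℝ) ≤ α * ((n : ℝ) / Real.log n) ^ (d / 2 + 1) →
      IsPsdHard (fun y => c - I.value y) n r :=
    fun r hr => hfd ▸ hhard d (hf d hd) n r hn hmn hr
  exact ⟨fun U hr hU => (hI_hard _ hr).not_psdCertifies hI (posSemidef_basisGram U) hU.psdCertifies,
    fun r R hr hR => (hI_hard r hr).not_psdCertifies hI R.point_psd hR.psdCertifies⟩

theorem mainTheorem4 {k : ℕ} (Preds : Finset ((Fin k → Bool) → Bool)) (m : ℕ) (c s : ℝ) :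
    ∃ α : ℝ, 0 < α ∧
      ∀ d : ℕ, ¬ SubspaceAchieves Preds (sosSubspace m d) c s →
        ∀ n : ℕ, m ≤ n → 2 ≤ n →
          (∀ U : Submodule ℝ (Cube n → ℝ),
            (Module.finrank ℝ U : ℝ) ≤ α * ((n : ℝ) / Real.log (n : ℝ)) ^ ((d : ℝ) / 4) →
              ¬ SubspaceAchieves Preds U c s) ∧
          (∀ (r : ℕ) (R : SDPRelaxation Preds n r),
            (r : ℝ) ≤ α * ((n : ℝ) / Real.log (n : ℝ)) ^ ((d : ℝ) / 4) →
              ¬ R.Achieves c s) := by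
  obtain ⟨α, hα, h⟩ := mainTheorem4_general Preds m c s
  refine ⟨α, hα, fun d hd n hmn hn => ?_⟩
  have hpow := mul_le_mul_of_nonneg_left (rpow_div_four_le_pow_half_succ hn d) hα.le
  exact (h d hd n hmn hn).imp (fun hU U hr => hU U (hr.trans hpow))
    fun hR r R hr => hR r R (hr.trans hpow)
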